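/- Consider the following random growth of the complete graph on $N$ vertices. At the start the pool contains the $N$ (virtual) vertices and no edges. At each step an element is drawn uniformly at random from the pool and becomes occupied (it leaves the pool); whenever the element is a vertex, the edges linking it to the previously occupied vertices are added to the pool as virtual edges. The process stops when all $N$ vertices and all $\binom N2$ edges are occupied. For $1\le n\le N$ let $X_n$ be the number of occupied edges at the moment when the $n$-th vertex becomes occupied. Then, as $N\to\infty$, the point process on $[0,\infty)$ with atoms $$\frac{\binom N2-X_{N-k}}{N\log N},\qquad k=0,1,\dots,N-1,$$ (counted with multiplicity) converges weakly, that is, in distribution with respect to the vague topology on locally finite measures, to a homogeneous Poisson process of unit rate. Moreover, for every $x>0$, at the stage when exactly $\lfloor x N\log N\rfloor$ of the $N+\binom N2$ elements (vertices and edges) remain to be occupied, the number $V_N$ of virtual (not yet occupied) vertices satisfies $$\lim_{N\to\infty}\mathbb P[V_N=j]=e^{-x}\frac{x^j}{j!},\qquad j=0,1,2,\dots .$$ -/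

import Mathlib

open MeasureTheory ProbabilityTheory Filter Topology
open scoped CompactlySupported

namespace GrowingGraph

/-! ### The random graph growth process -/

/-- The elements to be occupied: the `N` vertices and the `N.choose 2` edges of the complete
graph on the vertex set `Fin N`. -/
abbrev Element (N : ℕ) : Type := Fin N ⊕ {e : Sym2 (Fin N) // ¬ e.IsDiag}

/-- A history lists the elements occupied so far, in the order of their occupancy. The first `t`
steps of a history `h` form the history `h.take t`. -/
abbrev History (N : ℕ) : Type := List (Element N)

open Classical in
/-- Occupied vertices after the steps recorded in `h`. -/
noncomputable def occupiedVertices {N : ℕ} (h : History N) : Finset (Fin N) :=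
  Finset.univ.filter fun v => Sum.inl v ∈ h

open Classical in
/-- Occupied edges after the steps recorded in `h`. -/
noncomputable def occupiedEdges {N : ℕ} (h : History N) : Finset {e : Sym2 (Fin N) // ¬ e.IsDiag} :=
  Finset.univ.filter fun e => Sum.inr e ∈ h

open Classical in
/-- Virtual vertices: those not yet occupied. -/
noncomputable def virtualVertices {N : ℕ} (h : History N) : Finset (Fin N) :=
  Finset.univ.filter fun v => Sum.inl v ∉ h

open Classical in
/-- Virtual edges: the edges between occupied vertices that are not yet occupied. -/
noncomputable def virtualEdges {N : ℕ} (h : History N) : Finset {e : Sym2 (Fin N) // ¬ e.IsDiag} :=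
  Finset.univ.filter fun e => Sum.inr e ∉ h ∧ ∀ v ∈ e.1, v ∈ occupiedVertices h

/-- The pool of virtual vertices and edges. -/
noncomputable def pool {N : ℕ} (h : History N) : Finset (Element N) :=
  (virtualVertices h).disjSum (virtualEdges h)

/-- Law of the history after `t` steps: at each step an element drawn uniformly at random from
the current pool becomes occupied (nothing happens once the pool is empty, that is, once the
graph is complete). -/
noncomputable def historyLaw (N : ℕ) : ℕ → PMF (History N)
  | 0 => PMF.pure []
  | t + 1 => (historyLaw N t).bind fun h =>
      if hne : (pool h).Nonempty then (PMF.uniformOfFinset (pool h) hne).map fun x => h ++ [x]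
      else PMF.pure h

/-- Total number of elements, vertices and edges, of the complete graph on `N` vertices. -/
def totalElements (N : ℕ) : ℕ := N + N.choose 2

/-- Histories form a discrete probability space. -/
instance (N : ℕ) : MeasurableSpace (History N) := ⊤

/-- Law of the complete history, until the complete graph on `N` vertices is built. -/
noncomputable def growthMeasure (N : ℕ) : Measure (History N) :=
  (historyLaw N (totalElements N)).toMeasure

instance (N : ℕ) : IsProbabilityMeasure (growthMeasure N) :=
  PMF.toMeasure.isProbabilityMeasure _

/-- The number of steps made when the `n`-th vertex becomes occupied. -/
noncomputable def vertexTime {N : ℕ} (h : History N) (n : ℕ) : ℕ :=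
  sInf {t : ℕ | (occupiedVertices (h.take t)).card = n}

/-- `X_n`: the number of occupied edges at the moment when the `n`-th vertex becomes occupied. -/
noncomputable def edgeCount {N : ℕ} (h : History N) (n : ℕ) : ℕ :=
  (occupiedEdges (h.take (vertexTime h n))).card

/-! ### Point processes on the line -/

/-- Locally finite Borel measures on the real line. -/
structure LocFinMeasure where
  /-- The underlying measure. -/
  toMeasure : Measure ℝ
  /-- Bounded sets have finite measure. -/
  isLocallyFinite : IsLocallyFiniteMeasure toMeasure

/-- The vague topology: the coarsest one for which `μ ↦ ∫ f dμ` is continuous for every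
continuous function `f` with compact support. -/
noncomputable instance : TopologicalSpace LocFinMeasure :=
  TopologicalSpace.induced (fun μ (f : C_c(ℝ, ℝ)) => ∫ x, f x ∂μ.toMeasure) inferInstance

noncomputable instance : MeasurableSpace LocFinMeasure := borel LocFinMeasure

instance : BorelSpace LocFinMeasure := ⟨rfl⟩

open Classical in
/-- The point configuration (counting measure, with multiplicities) with atoms `a i`. If the
atoms accumulate, so that the counting measure is not locally finite, it is `0` by convention. -/
noncomputable def pointConfig {ι : Type} (a : ι → ℝ) : LocFinMeasure :=
  if ha : IsLocallyFiniteMeasure (Measure.sum fun i => Measure.dirac (a i)) then ⟨_, ha⟩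
  else ⟨0, inferInstance⟩

/-- With finitely many atoms the convention in `pointConfig` is not used. -/
theorem pointConfig_of_finite {ι : Type} [Finite ι] (a : ι → ℝ) :
    (pointConfig a).toMeasure = Measure.sum fun i => Measure.dirac (a i) := by
  have h : IsLocallyFiniteMeasure (Measure.sum fun i => Measure.dirac (a i)) := by
    cases nonempty_fintype ι
    rw [Measure.sum_fintype]; infer_instance
  rw [pointConfig, dif_pos h]

/-- The point process with atoms `(N.choose 2 - X_{N-k}) / (N log N)`, `k = 0, …, N - 1`. -/
noncomputable def reversedProcess (N : ℕ) (h : History N) : LocFinMeasure :=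
  pointConfig fun k : Fin N =>
    ((N.choose 2 : ℝ) - (edgeCount h (N - k) : ℝ)) / ((N : ℝ) * Real.log N)

instance : IsProbabilityMeasure (expMeasure 1) := isProbabilityMeasure_expMeasure one_pos

/-- The probability space of a sequence of independent exponential random variables with
mean one. -/
noncomputable def gapMeasure : Measure (ℕ → ℝ) := Measure.infinitePi fun _ => expMeasure 1

instance : IsProbabilityMeasure gapMeasure := by
  unfold gapMeasure; infer_instance

/-- The homogeneous Poisson process of unit rate on the half-line: the spacings between its
consecutive points, starting from the origin, are independent exponential with mean one. -/
noncomputable def poissonProcess (gap : ℕ → ℝ) : LocFinMeasure :=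
  pointConfig fun k : ℕ => ∑ i ∈ Finset.range (k + 1), gap i

end GrowingGraph

/-!
The proof couples the growth processes for all `N` with one Poisson process, in such a way that the
rescaled atoms converge almost surely.

Between the moments at which the number of virtual vertices drops from `k` to `k - 1`, the pool is
an urn with `k` vertices and, initially, some number `e` of edges, drawn without replacement. Hence
the number of edges left when the first vertex is drawn is at most `m` with probability
`(m + k).choose k / (e + k).choose k`, and the edge counts form a Markov chain whose transition
probabilities are increments of this distribution function. This is `growthMeasure_edgeCount`,
proved by checking that the conditional probability of a prescribed sequence of edge counts is a
martingale along the random history.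

On the other side, let `S₀ < S₁ < …` be the points of the Poisson process. The variables
`(Sᵢ / Sᵢ₊₁) ^ (i + 1)` are independent and uniform on the unit interval (`gapMeasure_ratio`, by the
beta-gamma algebra). Feeding the one with `i = k - 1` to the quantile function of the urn with `k`
vertices gives a copy of the edge counts on the probability space of the Poisson process
(`map_edgeCount_eq`). This quantile function is within `k` of the linear map with slope
`Sₖ₋₁ / Sₖ` (`le_edgesLeft`, `edgesLeft_le_mul`), so the number `w k` of virtual edges present when
`k` virtual vertices are left satisfies `w (k - 1) = w k * Sₖ₋₁ / Sₖ + N + O(k)`. Dividing by `Sₖ₋₁`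
this telescopes to `w k / Sₖ = N * ∑ 1 / Sᵢ + O(∑ (i + 1) / Sᵢ)`, with `k ≤ i < N` in both sums,
and `Sᵢ ~ i` by the strong law of large numbers. So `w k / (N log N) → Sₖ` almost surely, for every
fixed `k`; the edges not yet in the pool are at most `k N` in number and do not contribute
(`tendsto_coupled_atom`).

As the atoms are ordered and `Sₖ → ∞`, convergence of each atom gives vague convergence, whence the
convergence in distribution. For the last claim, at most `k` vertices are virtual when `R` elements
remain if and only if `k` plus the `k`-th atom, before rescaling, is at least `R`; so the
probability of this tends to that of `Sₖ ≥ x`, the Poisson distribution function.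
-/

namespace GrowingGraph

open scoped NNReal ENNReal

/-! ### Counting along a history -/

section Discrete

variable {N : ℕ}

/-- A history is admissible if no element is occupied twice and the endpoints of every occupied
edge are occupied. (The order of occupancy is not recorded here.) -/
def Admissible (h : History N) : Prop :=
  h.Nodup ∧ ∀ e, Sum.inr e ∈ h → ∀ v ∈ e.1, Sum.inl v ∈ h

theorem mem_occupiedVertices {h : History N} {v : Fin N} :
    v ∈ occupiedVertices h ↔ Sum.inl v ∈ h := by
  simp [occupiedVertices]

theorem mem_occupiedEdges {h : History N} {e : {e : Sym2 (Fin N) // ¬ e.IsDiag}} :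
    e ∈ occupiedEdges h ↔ Sum.inr e ∈ h := by
  simp [occupiedEdges]

theorem mem_virtualVertices {h : History N} {v : Fin N} :
    v ∈ virtualVertices h ↔ Sum.inl v ∉ h := by
  simp [virtualVertices]

theorem mem_virtualEdges {h : History N} {e : {e : Sym2 (Fin N) // ¬ e.IsDiag}} :
    e ∈ virtualEdges h ↔ Sum.inr e ∉ h ∧ ∀ v ∈ e.1, Sum.inl v ∈ h := by
  simp [virtualEdges, mem_occupiedVertices]

theorem card_occupiedVertices_le (h : History N) : (occupiedVertices h).card ≤ N :=
  (Finset.card_le_univ _).trans_eq (Fintype.card_fin N)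

theorem card_virtualVertices (h : History N) :
    (virtualVertices h).card = N - (occupiedVertices h).card := by
  have : virtualVertices h = (occupiedVertices h)ᶜ := by
    ext v; simp [mem_virtualVertices, mem_occupiedVertices]
  rw [this, Finset.card_compl, Fintype.card_fin]

open Classical in
theorem card_edges_within (S : Finset (Fin N)) :
    (Finset.univ.filter fun e : {e : Sym2 (Fin N) // ¬ e.IsDiag} => ∀ v ∈ e.1, v ∈ S).card
      = S.card.choose 2 := by
  rw [← Sym2.card_image_offDiag]
  apply Finset.card_nbij (fun e => e.1)
  · rintro ⟨e, he⟩ h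
    induction e with
    | _ a b =>
      simp at h he
      simp only [Finset.coe_image, Set.mem_image, SetLike.mem_coe, Finset.mem_offDiag]
      exact ⟨(a, b), ⟨h.1, h.2, he⟩, rfl⟩
  · intro a _ b _ h
    exact Subtype.ext h
  · intro e h
    simp only [Finset.coe_image, Set.mem_image, SetLike.mem_coe, Finset.mem_offDiag] at h
    obtain ⟨⟨a, b⟩, ⟨ha, hb, hab⟩, rfl⟩ := h
    refine ⟨⟨s(a, b), by simpa using hab⟩, ?_, rfl⟩
    simp [ha, hb]

theorem card_virtualEdges_add {h : History N} (hh : Admissible h) :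
    (virtualEdges h).card + (occupiedEdges h).card = (occupiedVertices h).card.choose 2 := by
  classical
  rw [← card_edges_within, ← Finset.card_union_of_disjoint]
  · congr 1
    ext e
    simp only [Finset.mem_union, mem_virtualEdges, mem_occupiedEdges, Finset.mem_filter,
      Finset.mem_univ, true_and, mem_occupiedVertices]
    constructor
    · rintro (h1 | h1)
      · exact h1.2
      · exact hh.2 e h1
    · intro h1
      by_cases h2 : Sum.inr e ∈ h
      · exact Or.inr h2
      · exact Or.inl ⟨h2, h1⟩
  · rw [Finset.disjoint_left]
    intro e h1 h2
    exact (mem_virtualEdges.1 h1).1 (mem_occupiedEdges.1 h2)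

theorem card_occupied_add {h : History N} (hh : h.Nodup) :
    (occupiedVertices h).card + (occupiedEdges h).card = h.length := by
  classical
  rw [← List.toFinset_card_of_nodup hh, ← Finset.card_disjSum]
  congr 1
  ext x
  cases x <;> simp [mem_occupiedVertices, mem_occupiedEdges]

theorem Admissible.edges_le {h : History N} (hh : Admissible h) :
    (occupiedEdges h).card ≤ (occupiedVertices h).card.choose 2 := by
  have := card_virtualEdges_add hh; omega

theorem card_pool {h : History N} (hh : Admissible h) :
    (pool h).card = (N - (occupiedVertices h).card)
      + ((occupiedVertices h).card.choose 2 - (occupiedEdges h).card) := by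
  have := card_virtualEdges_add hh
  rw [pool, Finset.card_disjSum, card_virtualVertices]
  omega

theorem admissible_nil : Admissible ([] : History N) := by
  simp [Admissible]

theorem Admissible.append {h : History N} (hh : Admissible h) {x : Element N} (hx : x ∈ pool h) :
    Admissible (h ++ [x]) := by
  rcases x with v | e
  · have hv : Sum.inl v ∉ h := by simpa [pool, mem_virtualVertices] using hx
    refine ⟨?_, ?_⟩
    · rw [List.nodup_append]
      refine ⟨hh.1, by simp, ?_⟩
      rintro a ha b hb rfl
      simp at hb; subst hb; exact hv ha
    · intro e he w hw
      have : Sum.inr e ∈ h := by simpa using he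
      simp [hh.2 e this w hw]
  · have he : Sum.inr e ∉ h ∧ ∀ v ∈ e.1, Sum.inl v ∈ h := by
      simpa only [pool, Finset.inr_mem_disjSum, mem_virtualEdges] using hx
    refine ⟨?_, ?_⟩
    · rw [List.nodup_append]
      refine ⟨hh.1, by simp, ?_⟩
      rintro a ha b hb rfl
      simp at hb; subst hb; exact he.1 ha
    · intro e' he' w hw
      have : Sum.inr e' ∈ h ∨ e' = e := by simpa using he'
      rcases this with h1 | h1
      · simp [hh.2 e' h1 w hw]
      · subst h1; simp [he.2 w hw]

theorem occupiedVertices_append_inl (h : History N) (v : Fin N) :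
    occupiedVertices (h ++ [Sum.inl v]) = insert v (occupiedVertices h) := by
  ext w; simp [mem_occupiedVertices, or_comm]

theorem occupiedVertices_append_inr (h : History N) (e : {e : Sym2 (Fin N) // ¬ e.IsDiag}) :
    occupiedVertices (h ++ [Sum.inr e]) = occupiedVertices h := by
  ext w; simp [mem_occupiedVertices]

theorem occupiedEdges_append_inl (h : History N) (v : Fin N) :
    occupiedEdges (h ++ [Sum.inl v]) = occupiedEdges h := by
  ext w; simp [mem_occupiedEdges]

open Classical in
theorem occupiedEdges_append_inr (h : History N) (e : {e : Sym2 (Fin N) // ¬ e.IsDiag}) :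
    occupiedEdges (h ++ [Sum.inr e]) = insert e (occupiedEdges h) := by
  ext w; simp [mem_occupiedEdges, or_comm]

theorem card_occupiedVertices_append_inl {h : History N} {v : Fin N} (hv : Sum.inl v ∉ h) :
    (occupiedVertices (h ++ [Sum.inl v])).card = (occupiedVertices h).card + 1 := by
  rw [occupiedVertices_append_inl, Finset.card_insert_of_notMem (by rwa [mem_occupiedVertices])]

theorem card_occupiedEdges_append_inr {h : History N} {e : {e : Sym2 (Fin N) // ¬ e.IsDiag}}
    (he : Sum.inr e ∉ h) :
    (occupiedEdges (h ++ [Sum.inr e])).card = (occupiedEdges h).card + 1 := by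
  classical
  rw [occupiedEdges_append_inr, Finset.card_insert_of_notMem (by rwa [mem_occupiedEdges])]

/-! ### Vertex times -/

theorem occupiedVertices_take_mono (h : History N) {s t : ℕ} (hst : s ≤ t) :
    (occupiedVertices (h.take s)).card ≤ (occupiedVertices (h.take t)).card := by
  apply Finset.card_le_card
  intro v hv
  rw [mem_occupiedVertices] at *
  exact (List.take_subset_take_left h hst) hv

theorem occupiedVertices_take_succ_le (h : History N) (t : ℕ) :
    (occupiedVertices (h.take (t + 1))).card ≤ (occupiedVertices (h.take t)).card + 1 := by
  by_cases ht : t < h.length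
  · rw [List.take_succ_eq_append_getElem ht]
    rcases h[t] with v | e
    · rw [occupiedVertices_append_inl]; exact Finset.card_insert_le _ _
    · rw [occupiedVertices_append_inr]; omega
  · rw [List.take_of_length_le (by omega), List.take_of_length_le (by omega)]; omega

theorem exists_card_take_eq (h : History N) {n : ℕ} (t : ℕ)
    (hn : n ≤ (occupiedVertices (h.take t)).card) :
    ∃ s ≤ t, (occupiedVertices (h.take s)).card = n := by
  induction t with
  | zero =>
    refine ⟨0, le_rfl, ?_⟩
    have : (occupiedVertices (h.take 0)).card = 0 := by simp [occupiedVertices]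
    omega
  | succ t ih =>
    by_cases h1 : n ≤ (occupiedVertices (h.take t)).card
    · obtain ⟨s, hs, h2⟩ := ih h1
      exact ⟨s, by omega, h2⟩
    · exact ⟨t + 1, le_rfl, by have := occupiedVertices_take_succ_le h t; omega⟩

theorem card_take_vertexTime (h : History N) {n : ℕ} (hn : n ≤ (occupiedVertices h).card) :
    (occupiedVertices (h.take (vertexTime h n))).card = n := by
  have : {t : ℕ | (occupiedVertices (h.take t)).card = n}.Nonempty := by
    obtain ⟨s, _, hs⟩ := exists_card_take_eq h (n := n) h.length (by rwa [List.take_length])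
    exact ⟨s, hs⟩
  exact Nat.sInf_mem this

theorem vertexTime_le_iff (h : History N) {n t : ℕ} (hn : n ≤ (occupiedVertices h).card) :
    vertexTime h n ≤ t ↔ n ≤ (occupiedVertices (h.take t)).card := by
  constructor
  · intro ht
    have := occupiedVertices_take_mono h ht
    rwa [card_take_vertexTime h hn] at this
  · intro ht
    obtain ⟨s, hs, h1⟩ := exists_card_take_eq h t ht
    exact le_trans (Nat.sInf_le h1) hs

theorem vertexTime_le_length (h : History N) {n : ℕ} (hn : n ≤ (occupiedVertices h).card) :
    vertexTime h n ≤ h.length := by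
  rw [vertexTime_le_iff h hn, List.take_length]; exact hn

theorem vertexTime_append (h : History N) (x : Element N) {n : ℕ}
    (hn : n ≤ (occupiedVertices h).card) : vertexTime (h ++ [x]) n = vertexTime h n := by
  have hn' : n ≤ (occupiedVertices (h ++ [x])).card :=
    hn.trans (Finset.card_le_card fun v hv => by
      rw [mem_occupiedVertices] at *
      exact List.mem_append_left _ hv)
  refine eq_of_forall_ge_iff fun t => ?_
  rw [vertexTime_le_iff _ hn', vertexTime_le_iff _ hn]
  rcases le_or_gt t h.length with ht | ht
  · rw [List.take_append_of_le_length ht]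
  · rw [List.take_of_length_le (by simp; omega), List.take_of_length_le (by omega)]
    simp [hn, hn']

theorem edgeCount_append (h : History N) (x : Element N) {n : ℕ}
    (hn : n ≤ (occupiedVertices h).card) : edgeCount (h ++ [x]) n = edgeCount h n := by
  rw [edgeCount, vertexTime_append h x hn, edgeCount,
    List.take_append_of_le_length (vertexTime_le_length h hn)]

theorem edgeCount_append_inl {h : History N} {v : Fin N} (hv : Sum.inl v ∉ h) :
    edgeCount (h ++ [Sum.inl v]) ((occupiedVertices h).card + 1) = (occupiedEdges h).card := by
  have hc := card_occupiedVertices_append_inl hv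
  have : vertexTime (h ++ [Sum.inl v]) ((occupiedVertices h).card + 1) = h.length + 1 := by
    refine eq_of_forall_ge_iff fun t => ?_
    rw [vertexTime_le_iff _ hc.ge]
    constructor
    · intro h1
      by_contra h2
      rw [List.take_append_of_le_length (by omega)] at h1
      have := occupiedVertices_take_mono h (show t ≤ h.length by omega)
      rw [List.take_length] at this
      omega
    · intro h1
      rw [List.take_of_length_le (by simpa using h1), hc]
  rw [edgeCount, this, List.take_of_length_le (by simp), occupiedEdges_append_inl]

theorem edgeCount_zero (h : History N) : edgeCount h 0 = 0 := by
  have : vertexTime h 0 = 0 := by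
    rw [← Nat.le_zero, vertexTime_le_iff h (Nat.zero_le _)]; exact Nat.zero_le _
  rw [edgeCount, this]
  simp [occupiedEdges]

theorem vertexTime_eq {h : History N} (hh : h.Nodup) {n : ℕ}
    (hn : n ≤ (occupiedVertices h).card) : vertexTime h n = n + edgeCount h n := by
  have h1 := card_occupied_add (hh.sublist (List.take_sublist (vertexTime h n) h))
  rw [card_take_vertexTime h hn, List.length_take,
    min_eq_left (vertexTime_le_length h hn)] at h1
  exact h1.symm

/-! ### Support of the law -/

theorem admissible_of_mem_support {t : ℕ} {h : History N} (hh : h ∈ (historyLaw N t).support) :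
    Admissible h := by
  induction t generalizing h with
  | zero =>
    simp only [historyLaw, PMF.support_pure, Set.mem_singleton_iff] at hh
    subst hh; exact admissible_nil
  | succ t ih =>
    simp only [historyLaw, PMF.mem_support_bind_iff] at hh
    obtain ⟨h', h1, h2⟩ := hh
    split_ifs at h2 with hne
    · simp only [PMF.mem_support_map_iff, PMF.mem_support_uniformOfFinset_iff] at h2
      obtain ⟨x, hx, rfl⟩ := h2
      exact (ih h1).append hx
    · simp only [PMF.support_pure, Set.mem_singleton_iff] at h2
      subst h2; exact ih h1

theorem Admissible.pool_nonempty {h : History N} (hh : Admissible h)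
    (hl : h.length < totalElements N) : (pool h).Nonempty := by
  rw [← Finset.card_pos, card_pool hh]
  have h1 := card_occupied_add hh.1
  have h2 := card_occupiedVertices_le h
  have h3 := hh.edges_le
  by_contra h4
  have h5 : (occupiedVertices h).card = N := by omega
  rw [h5] at h1 h3 h4
  rw [totalElements] at hl
  omega

theorem length_of_mem_support {t : ℕ} (ht : t ≤ totalElements N) {h : History N}
    (hh : h ∈ (historyLaw N t).support) : h.length = t := by
  induction t generalizing h with
  | zero =>
    simp only [historyLaw, PMF.support_pure, Set.mem_singleton_iff] at hh
    subst hh; rfl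
  | succ t ih =>
    simp only [historyLaw, PMF.mem_support_bind_iff] at hh
    obtain ⟨h', h1, h2⟩ := hh
    have hl := ih (by omega) h1
    rw [dif_pos ((admissible_of_mem_support h1).pool_nonempty (by omega))] at h2
    simp only [PMF.mem_support_map_iff, PMF.mem_support_uniformOfFinset_iff] at h2
    obtain ⟨x, hx, rfl⟩ := h2
    simp [hl]

theorem card_occupiedVertices_of_mem_support {h : History N}
    (hh : h ∈ (historyLaw N (totalElements N)).support) : (occupiedVertices h).card = N := by
  have ha := admissible_of_mem_support hh
  have h1 := card_occupied_add ha.1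
  rw [length_of_mem_support le_rfl hh, totalElements] at h1
  have h2 := card_occupiedVertices_le h
  have h3 := ha.edges_le
  have h4 := Nat.choose_le_choose 2 h2
  omega

theorem ae_growthMeasure {P : History N → Prop}
    (hP : ∀ h ∈ (historyLaw N (totalElements N)).support, P h) : ∀ᵐ h ∂growthMeasure N, P h := by
  rw [ae_iff, growthMeasure, PMF.toMeasure_apply_eq_zero_iff _ (by trivial), Set.disjoint_left]
  intro h h1 h2
  exact h2 (hP h h1)

/-- At the stage when `R` elements remain, at most `k` vertices are virtual if and only if
`N - k` vertices were occupied at least that many elements before the end. -/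
theorem card_virtualVertices_take_le_iff {h : History N}
    (hh : h ∈ (historyLaw N (totalElements N)).support) {R k : ℕ} (hR : R ≤ totalElements N)
    (hk : k ≤ N) :
    (virtualVertices (h.take (totalElements N - R))).card ≤ k ↔
      R + edgeCount h (N - k) ≤ k + N.choose 2 := by
  have hc := card_occupiedVertices_of_mem_support hh
  have hn : N - k ≤ (occupiedVertices h).card := by omega
  have h1 := vertexTime_le_iff h (t := totalElements N - R) hn
  rw [vertexTime_eq (admissible_of_mem_support hh).1 hn] at h1
  rw [card_virtualVertices]
  rw [totalElements] at *
  omega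

end Discrete

/-! ### The law of the edge counts -/

/-- The probability that `j` edges are left when the first vertex is drawn, drawing without
replacement from a pool of `k > 0` vertices and `e` edges. -/
noncomputable def firstVertexProb (k e j : ℕ) : ℝ≥0 :=
  if j ≤ e then ((j + k - 1).choose (k - 1) : ℝ≥0) / ((e + k).choose k : ℝ≥0) else 0

/-- The transition probability from `m` to `m'` of the number of occupied edges, observed at the
times at which the `n`-th and the `(n + 1)`-st vertex become occupied. -/
noncomputable def stepProb (N n m m' : ℕ) : ℝ≥0 :=
  if m' ≤ n.choose 2 then firstVertexProb (N - n) (n.choose 2 - m) (n.choose 2 - m') else 0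

/-- First-step analysis for drawing from a pool of `k` vertices and `e` edges. -/
theorem firstVertexProb_rec (k e j : ℕ) (hk : 0 < k) :
    (k + e) * firstVertexProb k e j =
      k * (if e = j then 1 else 0) + e * (if j < e then firstVertexProb k (e - 1) j else 0) := by
  obtain ⟨k, rfl⟩ := Nat.exists_eq_succ_of_ne_zero hk.ne'
  rcases lt_trichotomy e j with h | rfl | h
  · simp [firstVertexProb, h.not_ge, h.not_gt, h.ne]
  · simp only [firstVertexProb, le_refl, if_true, lt_irrefl, if_false, mul_one, mul_zero, add_zero]
    have h1 := Nat.add_one_mul_choose_eq (e + k) k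
    have h2 : (((e + (k + 1)).choose (k + 1) : ℕ) : ℝ≥0) ≠ 0 := by
      exact_mod_cast (Nat.choose_pos (by omega)).ne'
    rw [mul_div_assoc', div_eq_iff h2]
    have h3 : e + (k + 1) - 1 = e + k := by omega
    rw [Nat.succ_eq_add_one, h3, Nat.add_sub_cancel]
    have h4 : ((e + k + 1 : ℕ) : ℝ≥0) * ((e + k).choose k : ℕ)
      = ((e + (k + 1)).choose (k + 1) : ℕ) * ((k + 1 : ℕ) : ℝ≥0) := by exact_mod_cast h1
    push_cast at h4 ⊢
    rw [mul_comm ((k : ℝ≥0) + 1) _, ← h4]; ring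
  · obtain ⟨e, rfl⟩ := Nat.exists_eq_succ_of_ne_zero (show e ≠ 0 by omega)
    have hj : j ≤ e := by omega
    simp only [firstVertexProb, h.le, if_true, h, h.ne', if_false, mul_zero, zero_add,
      Nat.succ_eq_add_one, Nat.add_sub_cancel, hj]
    have h2 : (((e + 1 + (k + 1)).choose (k + 1) : ℕ) : ℝ≥0) ≠ 0 := by
      exact_mod_cast (Nat.choose_pos (by omega)).ne'
    have h2' : (((e + (k + 1)).choose (k + 1) : ℕ) : ℝ≥0) ≠ 0 := by
      exact_mod_cast (Nat.choose_pos (by omega)).ne'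
    have h1 := Nat.choose_mul_succ_eq (e + (k + 1)) (k + 1)
    have h4 : ((e + (k + 1)).choose (k + 1) : ℝ≥0) * ((e + (k + 1) + 1 : ℕ) : ℝ≥0)
        = (e + 1 + (k + 1)).choose (k + 1) * ((e + 1 : ℕ) : ℝ≥0) := by
      rw [show e + 1 + (k + 1) = e + (k + 1) + 1 by ring]
      rw [show e + (k + 1) + 1 - (k + 1) = e + 1 by omega] at h1
      exact_mod_cast h1
    rw [mul_div_assoc', mul_div_assoc', div_eq_div_iff h2 h2']
    push_cast at h4 ⊢
    calc _ = ((j + k).choose k : ℝ≥0) * (((e + (k + 1)).choose (k + 1) : ℝ≥0)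
          * (e + (k + 1) + 1)) := by
          rw [show j + (k + 1) - 1 = j + k by omega]; ring
      _ = _ := by
          rw [h4, show j + (k + 1) - 1 = j + k by omega]; ring

section Law

variable {N : ℕ}

/-- One step of the growth, as an average over the pool. -/
theorem tsum_historyLaw_succ (t : ℕ) (M : History N → ℝ≥0∞) :
    ∑' h, historyLaw N (t + 1) h * M h = ∑' h, historyLaw N t h *
      (if (pool h).Nonempty then ((pool h).card : ℝ≥0∞)⁻¹ * ∑ x ∈ pool h, M (h ++ [x])
        else M h) := by
  classical
  simp only [historyLaw, PMF.bind_apply]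
  simp_rw [← ENNReal.tsum_mul_right]
  rw [ENNReal.tsum_comm]
  congr 1
  ext h
  simp_rw [mul_assoc]
  rw [ENNReal.tsum_mul_left]
  congr 1
  split_ifs with hne
  · simp_rw [PMF.map_apply, ← ENNReal.tsum_mul_right]
    rw [ENNReal.tsum_comm]
    rw [Finset.mul_sum]
    trans ∑' x, if x ∈ pool h then ((pool h).card : ℝ≥0∞)⁻¹ * M (h ++ [x]) else 0
    · congr 1
      ext x
      rw [tsum_eq_single (h ++ [x])]
      · simp only [if_true, PMF.uniformOfFinset_apply]
        split_ifs <;> simp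
      · intro b hb; simp [hb]
    · rw [tsum_fintype, Finset.sum_ite_mem, Finset.univ_inter]
  · simp [PMF.pure_apply]

/-- The history agrees with the prescribed edge counts `x` so far. -/
def Consistent (x : ℕ → ℕ) (h : History N) : Prop :=
  ∀ n ≤ (occupiedVertices h).card, edgeCount h n = x n

open Classical in
/-- The conditional probability, given an admissible history so far, that the edge counts will be as
prescribed by `x`. -/
noncomputable def pathProb (x : ℕ → ℕ) (h : History N) : ℝ≥0 :=
  (if Consistent x h then 1 else 0) *
    if (occupiedVertices h).card < N then
      stepProb N (occupiedVertices h).card (occupiedEdges h).card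
          (x ((occupiedVertices h).card + 1)) *
        ∏ i ∈ Finset.Ico ((occupiedVertices h).card + 1) N, stepProb N i (x i) (x (i + 1))
    else 1

theorem consistent_append_inr (x : ℕ → ℕ) (h : History N) (e : {e : Sym2 (Fin N) // ¬ e.IsDiag}) :
    Consistent x (h ++ [Sum.inr e]) ↔ Consistent x h := by
  rw [Consistent, Consistent, occupiedVertices_append_inr]
  refine forall₂_congr fun n hn => ?_
  rw [edgeCount_append h _ hn]

theorem consistent_append_inl (x : ℕ → ℕ) {h : History N} {v : Fin N} (hv : Sum.inl v ∉ h) :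
    Consistent x (h ++ [Sum.inl v]) ↔
      Consistent x h ∧ (occupiedEdges h).card = x ((occupiedVertices h).card + 1) := by
  rw [Consistent, Consistent, card_occupiedVertices_append_inl hv]
  constructor
  · intro H
    refine ⟨fun n hn => ?_, ?_⟩
    · rw [← edgeCount_append h _ hn]; exact H n (by omega)
    · rw [← edgeCount_append_inl hv]; exact H _ le_rfl
  · rintro ⟨H1, H2⟩ n hn
    rcases Nat.lt_or_ge (occupiedVertices h).card n with h1 | h1
    · obtain rfl : n = (occupiedVertices h).card + 1 := by omega
      rw [edgeCount_append_inl hv, H2]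
    · rw [edgeCount_append h _ h1, H1 n h1]

open Classical in
theorem pathProb_append_inl (x : ℕ → ℕ) {h : History N} {v : Fin N} (hv : Sum.inl v ∉ h) :
    pathProb x (h ++ [Sum.inl v]) =
      (if Consistent x h then 1 else 0) *
      (if (occupiedEdges h).card = x ((occupiedVertices h).card + 1) then 1 else 0) *
        ∏ i ∈ Finset.Ico ((occupiedVertices h).card + 1) N, stepProb N i (x i) (x (i + 1)) := by
  rw [pathProb]
  simp only [consistent_append_inl x hv, card_occupiedVertices_append_inl hv,
    occupiedEdges_append_inl]
  by_cases h1 : Consistent x h <;>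
    by_cases h2 : (occupiedEdges h).card = x ((occupiedVertices h).card + 1) <;> simp only [h1, h2]
  · simp only [and_self, if_true, one_mul]
    split_ifs with h3
    · rw [Finset.prod_eq_prod_Ico_succ_bot h3]
    · rw [Finset.Ico_eq_empty_of_le (by omega), Finset.prod_empty]
  all_goals simp

open Classical in
theorem pathProb_append_inr (x : ℕ → ℕ) {h : History N}
    {e : {e : Sym2 (Fin N) // ¬ e.IsDiag}} (he : Sum.inr e ∉ h) :
    pathProb x (h ++ [Sum.inr e]) = (if Consistent x h then 1 else 0) *
    if (occupiedVertices h).card < N then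
      stepProb N (occupiedVertices h).card ((occupiedEdges h).card + 1)
          (x ((occupiedVertices h).card + 1)) *
        ∏ i ∈ Finset.Ico ((occupiedVertices h).card + 1) N, stepProb N i (x i) (x (i + 1))
    else 1 := by
  rw [pathProb]
  simp only [consistent_append_inr, card_occupiedEdges_append_inr he, occupiedVertices_append_inr]

theorem stepProb_rec {n m m' : ℕ} (hn : n < N) (hm : m ≤ n.choose 2) :
    (((N - n) + (n.choose 2 - m) : ℕ) : ℝ≥0) * stepProb N n m m' =
      ((N - n : ℕ) : ℝ≥0) * (if m = m' then 1 else 0) +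
        ((n.choose 2 - m : ℕ) : ℝ≥0) * stepProb N n (m + 1) m' := by
  rw [stepProb, stepProb]
  split_ifs with h1 h2
  · rw [Nat.cast_add, firstVertexProb_rec _ _ _ (by omega)]
    congr 1
    · rw [if_pos (by omega)]
    · rw [Nat.sub_sub]
      split_ifs with h3
      · rfl
      · by_cases h4 : n.choose 2 - m = 0
        · simp [h4]
        · rw [firstVertexProb, if_neg (by omega)]
  · rw [Nat.cast_add, firstVertexProb_rec _ _ _ (by omega)]
    congr 1
    · rw [if_neg (by omega)]
    · rw [Nat.sub_sub]
      split_ifs with h3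
      · rfl
      · by_cases h4 : n.choose 2 - m = 0
        · simp [h4]
        · rw [firstVertexProb, if_neg (by omega)]
  · omega
  · simp

/-- The conditional probability of prescribed edge counts is a martingale: its average over the
elements of the pool is its current value. -/
theorem sum_pathProb_append (x : ℕ → ℕ) {h : History N} (hh : Admissible h) :
    ∑ y ∈ pool h, pathProb x (h ++ [y]) = ((pool h).card : ℝ≥0) * pathProb x h := by
  classical
  have hV : ∀ v ∈ virtualVertices h, Sum.inl v ∉ h := fun v hv => mem_virtualVertices.1 hv
  have hE : ∀ e ∈ virtualEdges h, Sum.inr e ∉ h := fun e he => (mem_virtualEdges.1 he).1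
  rw [card_pool hh]
  have h1 := card_virtualEdges_add hh
  have h2 := card_occupiedVertices_le h
  rw [pool, Finset.sum_disjSum,
    Finset.sum_congr rfl (fun v hv => pathProb_append_inl x (hV v hv)),
    Finset.sum_congr rfl (fun e he => pathProb_append_inr x (hE e he)),
    Finset.sum_const, Finset.sum_const, card_virtualVertices,
    show (virtualEdges h).card = (occupiedVertices h).card.choose 2 - (occupiedEdges h).card by
      omega, pathProb, nsmul_eq_mul, nsmul_eq_mul]
  split_ifs with h3 h4 h5 h5
  all_goals try simp only [zero_mul, mul_zero, add_zero, one_mul]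
  all_goals try simp only [show N - (occupiedVertices h).card = 0 by omega]
  all_goals try simp
  all_goals have h6 := stepProb_rec (m' := x ((occupiedVertices h).card + 1)) h5 hh.edges_le
  · rw [if_pos h4] at h6
    rw [mul_one] at h6
    push_cast at h6
    rw [← mul_assoc, ← mul_assoc, h6]; ring
  · rw [if_neg h4] at h6
    push_cast at h6
    rw [← mul_assoc, ← mul_assoc, h6]; ring

theorem tsum_pathProb (x : ℕ → ℕ) (t : ℕ) :
    ∑' h, historyLaw N t h * (pathProb x h : ℝ≥0∞) = (pathProb x ([] : History N) : ℝ≥0∞) := by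
  induction t with
  | zero =>
    rw [tsum_eq_single []]
    · simp [historyLaw]
    · intro b hb; simp [historyLaw, hb]
  | succ t ih =>
    rw [tsum_historyLaw_succ, ← ih]
    congr 1
    ext h
    by_cases hs : h ∈ (historyLaw N t).support
    · congr 1
      split_ifs with hne
      · have h1 := sum_pathProb_append x (admissible_of_mem_support hs)
        rw [← ENNReal.ofNNReal_finsetSum, h1, ENNReal.coe_mul, ENNReal.coe_natCast, ← mul_assoc,
          ENNReal.inv_mul_cancel, one_mul]
        · simpa using hne.ne_empty
        · simp
      · rfl
    · rw [PMF.mem_support_iff, not_not] at hs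
      simp [hs]

/-- The edge counts form a Markov chain with transition probabilities `stepProb`. -/
theorem growthMeasure_edgeCount (x : ℕ → ℕ) (hx : x 0 = 0) :
    growthMeasure N {h | ∀ n ≤ N, edgeCount h n = x n} =
      ((∏ n ∈ Finset.range N, stepProb N n (x n) (x (n + 1)) : ℝ≥0) : ℝ≥0∞) := by
  classical
  have h0 : pathProb x ([] : History N) =
      ∏ n ∈ Finset.range N, stepProb N n (x n) (x (n + 1)) := by
    have hv : (occupiedVertices ([] : History N)).card = 0 := by simp [occupiedVertices]
    have he : (occupiedEdges ([] : History N)).card = 0 := by simp [occupiedEdges]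
    rw [pathProb, if_pos, hv, he, one_mul, Finset.range_eq_Ico]
    · split_ifs with h
      · rw [Finset.prod_eq_prod_Ico_succ_bot h, hx]
      · rw [Finset.Ico_eq_empty_of_le (by omega), Finset.prod_empty]
    · intro n hn
      rw [hv, Nat.le_zero] at hn
      rw [hn, edgeCount_zero, hx]
  rw [← h0, ← tsum_pathProb x (totalElements N), growthMeasure, PMF.toMeasure_apply _ (by trivial)]
  congr 1
  ext h
  by_cases hs : h ∈ (historyLaw N (totalElements N)).support
  · have hc := card_occupiedVertices_of_mem_support hs
    rw [pathProb, hc, if_neg (lt_irrefl _), Consistent, hc]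
    by_cases h1 : ∀ n ≤ N, edgeCount h n = x n
    · rw [Set.indicator_of_mem (by exact h1), if_pos h1]; simp
    · rw [Set.indicator_of_notMem (by exact h1), if_neg h1]; simp
  · rw [PMF.mem_support_iff, not_not] at hs
    rw [Set.indicator_apply, hs]
    simp

end Law

/-! ### The points of the Poisson process -/

/-- The `i`-th point, counted from `0`, of the Poisson process with spacings `gap`. -/
noncomputable def arrival (i : ℕ) (gap : ℕ → ℝ) : ℝ := ∑ j ∈ Finset.range (i + 1), gap j

/-- The ratio of two consecutive points of the Poisson process. -/
noncomputable def ratio (i : ℕ) (gap : ℕ → ℝ) : ℝ := arrival i gap / arrival (i + 1) gap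

/-- The density of the `n`-th point of the Poisson process, a Gamma density with shape
parameter `n + 1`. -/
noncomputable def arrivalDensity (n : ℕ) (t : ℝ) : ℝ≥0∞ :=
  if 0 < t then ENNReal.ofReal (t ^ n / n.factorial * Real.exp (-t)) else 0

/-- The density `(n + 1) b ^ n` on the unit interval, of the ratio of the points `n` and `n + 1`
of the Poisson process. -/
noncomputable def ratioDensity (n : ℕ) (b : ℝ) : ℝ≥0∞ :=
  if 0 < b ∧ b < 1 then ENNReal.ofReal ((n + 1) * b ^ n) else 0

theorem arrival_zero (g : ℕ → ℝ) : arrival 0 g = g 0 := by simp [arrival]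

theorem arrival_succ (n : ℕ) (g : ℕ → ℝ) : arrival (n + 1) g = arrival n g + g (n + 1) := by
  rw [arrival, Finset.sum_range_succ, arrival]

@[fun_prop]
theorem measurable_arrival (n : ℕ) : Measurable (arrival n) := by
  unfold arrival; fun_prop

@[fun_prop]
theorem measurable_ratio (n : ℕ) : Measurable (ratio n) := by
  unfold ratio; fun_prop

@[fun_prop]
theorem measurable_arrivalDensity (n : ℕ) : Measurable (arrivalDensity n) := by
  unfold arrivalDensity
  exact Measurable.ite measurableSet_Ioi (by fun_prop) measurable_const

@[fun_prop]
theorem measurable_ratioDensity (n : ℕ) : Measurable (ratioDensity n) := by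
  unfold ratioDensity
  exact Measurable.ite measurableSet_Ioo (by fun_prop) measurable_const

theorem lintegral_expMeasure_one {f : ℝ → ℝ≥0∞} (hf : Measurable f) :
    ∫⁻ y, f y ∂expMeasure 1 = ∫⁻ y, arrivalDensity 0 y * f y := by
  rw [expMeasure, gammaMeasure, lintegral_withDensity_eq_lintegral_mul _
    (by exact measurable_exponentialPDFReal 1 |>.ennreal_ofReal) hf]
  apply lintegral_congr_ae
  have : ∀ᵐ y : ℝ, y ≠ 0 := by simp [ae_iff]
  filter_upwards [this] with y hy
  have h1 := exponentialPDF_eq 1 y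
  rw [exponentialPDF, exponentialPDFReal] at h1
  simp only [Pi.mul_apply, gammaPDF, h1, arrivalDensity]
  rcases lt_or_gt_of_ne hy with h | h
  · simp [h.not_ge, h.not_gt]
  · simp [h.le, h]

theorem lintegral_eval_gapMeasure (n : ℕ) {f : ℝ → ℝ≥0∞} (hf : Measurable f) :
    ∫⁻ g, f (g n) ∂gapMeasure = ∫⁻ y, f y ∂expMeasure 1 := by
  have := (measurePreserving_eval_infinitePi (fun _ : ℕ => expMeasure 1) n).lintegral_comp hf
  simpa [gapMeasure] using this

theorem ae_gap_pos : ∀ᵐ g ∂gapMeasure, ∀ n, 0 < g n := by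
  rw [ae_all_iff]
  intro n
  have hm : Measurable ((Set.Iic (0 : ℝ)).indicator (1 : ℝ → ℝ≥0∞)) :=
    measurable_one.indicator measurableSet_Iic
  have h1 := lintegral_eval_gapMeasure n hm
  rw [lintegral_expMeasure_one hm] at h1
  have h2 : ∀ y, arrivalDensity 0 y * (Set.Iic (0 : ℝ)).indicator (1 : ℝ → ℝ≥0∞) y = 0 := by
    intro y
    by_cases hy : 0 < y
    · simp [hy]
    · simp [arrivalDensity, hy]
  simp only [h2, lintegral_zero] at h1
  rw [lintegral_eq_zero_iff (by exact hm.comp (measurable_pi_apply n))] at h1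
  filter_upwards [h1] with g hg
  by_contra h3
  simp [not_lt.1 h3] at hg

theorem arrival_pos {g : ℕ → ℝ} (hg : ∀ n, 0 < g n) (n : ℕ) : 0 < arrival n g :=
  Finset.sum_pos (fun i _ => hg i) (by simp)

theorem ratio_mem_Ioo {g : ℕ → ℝ} (hg : ∀ n, 0 < g n) (n : ℕ) : ratio n g ∈ Set.Ioo 0 1 := by
  have h1 := arrival_pos hg n
  have h2 := hg (n + 1)
  rw [ratio, arrival_succ]
  exact ⟨by positivity, by rw [div_lt_one (by positivity)]; linarith⟩

theorem lintegral_eq_mul_lintegral_comp_mul {s : ℝ} (hs : 0 < s) {G : ℝ → ℝ≥0∞}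
    (hG : Measurable G) : ∫⁻ t, G t = ENNReal.ofReal s * ∫⁻ b, G (s * b) := by
  conv_lhs => rw [← Real.smul_map_volume_mul_left hs.ne']
  rw [lintegral_smul_measure, lintegral_map hG (by fun_prop), abs_of_pos hs, smul_eq_mul]

/-- Conditioning on the `(n + 1)`-st point: the sum and the ratio of the `n`-th point and an
independent exponential gap are independent of each other, with the expected densities. -/
theorem lintegral_arrivalDensity_mul (n : ℕ) {a f : ℝ → ℝ≥0∞} (ha : Measurable a)
    (hf : Measurable f) :
    ∫⁻ t, arrivalDensity n t * ∫⁻ y, arrivalDensity 0 y * (a (t / (t + y)) * f (t + y)) =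
      (∫⁻ b, ratioDensity n b * a b) * ∫⁻ s, arrivalDensity (n + 1) s * f s := by
  -- substitute `s = t + y`, exchange the integrals and substitute `t = s * b`
  set K : ℝ → ℝ → ℝ≥0∞ := fun t s =>
    if 0 < t ∧ t < s then ENNReal.ofReal (t ^ n / n.factorial * Real.exp (-s)) *
      (a (t / s) * f s) else 0 with hK
  have hKm : Measurable (Function.uncurry K) := by
    apply Measurable.ite
    · exact (measurableSet_lt measurable_const measurable_fst).inter
        (measurableSet_lt measurable_fst measurable_snd)
    · fun_prop
    · fun_prop
  have h1 : ∀ t, arrivalDensity n t * ∫⁻ y, arrivalDensity 0 y * (a (t / (t + y)) * f (t + y))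
      = ∫⁻ s, K t s := by
    intro t
    rw [← lintegral_const_mul _ (by fun_prop), ← lintegral_add_left_eq_self (K t) t]
    congr 1
    ext y
    simp only [arrivalDensity, hK, lt_add_iff_pos_right]
    by_cases ht : 0 < t <;> by_cases hy : 0 < y <;> simp only [ht, hy, if_true, if_false,
      and_self, and_false, false_and, zero_mul, mul_zero]
    rw [← mul_assoc, ← ENNReal.ofReal_mul (by positivity)]
    congr 2
    rw [neg_add, Real.exp_add]
    simp; ring
  simp_rw [h1]
  rw [lintegral_lintegral_swap hKm.aemeasurable, ← lintegral_const_mul _ (by fun_prop)]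
  congr 1
  ext s
  by_cases hs : 0 < s
  · rw [lintegral_eq_mul_lintegral_comp_mul hs (by fun_prop), mul_comm (∫⁻ b, _),
      ← lintegral_const_mul _ (by fun_prop), ← lintegral_const_mul _ (by fun_prop)]
    congr 1
    ext b
    have e1 : 0 < s * b ↔ 0 < b := mul_pos_iff_of_pos_left hs
    have e2 : s * b < s ↔ b < 1 := by
      conv_lhs => rhs; rw [← mul_one s]
      exact mul_lt_mul_iff_right₀ hs
    simp only [hK, arrivalDensity, ratioDensity, e1, e2, hs, if_true]
    split_ifs with hb
    · rw [mul_div_cancel_left₀ _ hs.ne']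
      have : ENNReal.ofReal s * ENNReal.ofReal ((s * b) ^ n / n.factorial * Real.exp (-s)) =
          ENNReal.ofReal (s ^ (n + 1) / (n + 1).factorial * Real.exp (-s)) *
            ENNReal.ofReal ((n + 1) * b ^ n) := by
        have hb0 := hb.1
        rw [← ENNReal.ofReal_mul hs.le, ← ENNReal.ofReal_mul (by positivity)]
        congr 1
        rw [Nat.factorial_succ]
        push_cast
        field_simp
        ring
      rw [← mul_assoc, this]; ring
    · simp
  · have : ∀ t, K t s = 0 := fun t => if_neg fun h => hs (h.1.trans h.2)
    simp [this, arrivalDensity, hs]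

theorem indepFun_gap (n : ℕ) {E : Type*} [MeasurableSpace E] {X : (ℕ → ℝ) → E}
    (hX : Measurable X) (hdep : ∀ g g', (∀ i < n, g i = g' i) → X g = X g') :
    IndepFun X (fun g => g n) gapMeasure := by
  have hi : iIndepFun (fun (i : ℕ) (g : ℕ → ℝ) => g i) gapMeasure :=
    iIndepFun_infinitePi (P := fun _ : ℕ => expMeasure 1) (X := fun _ x => x) (by fun_prop)
  have h1 := hi.indepFun_finset (Finset.range n) {n} (by simp) (by fun_prop)
  classical
  set ext : (Finset.range n → ℝ) → ℕ → ℝ := fun r i =>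
    if h : i ∈ Finset.range n then r ⟨i, h⟩ else 0 with hext
  have hem : Measurable ext := by
    rw [measurable_pi_iff]
    intro i
    by_cases h : i ∈ Finset.range n
    · simp only [hext, h, dif_pos]; fun_prop
    · simp only [hext, h, dif_neg, not_false_eq_true]; fun_prop
  have hev : Measurable fun r : ({n} : Finset ℕ) → ℝ => r ⟨n, Finset.mem_singleton_self n⟩ :=
    measurable_pi_apply (⟨n, Finset.mem_singleton_self n⟩ : ({n} : Finset ℕ))
  have h2 := h1.comp (hX.comp hem) hev
  convert h2 using 1
  · ext g
    apply hdep
    intro i hi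
    simp [hext, hi]
  · rfl

/-- Integrating out a gap that is independent of the variables depending on the earlier gaps. -/
theorem lintegral_gap_indep (n : ℕ) {P : (ℕ → ℝ) → ℝ≥0∞} {S : (ℕ → ℝ) → ℝ}
    (hP : Measurable P) (hS : Measurable S)
    (hdepP : ∀ g g', (∀ i < n, g i = g' i) → P g = P g')
    (hdepS : ∀ g g', (∀ i < n, g i = g' i) → S g = S g') {F : ℝ → ℝ → ℝ≥0∞}
    (hF : Measurable (Function.uncurry F)) :
    ∫⁻ g, P g * F (S g) (g n) ∂gapMeasure =
      ∫⁻ g, P g * ∫⁻ y, F (S g) y ∂expMeasure 1 ∂gapMeasure := by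
  have hi := indepFun_gap n (X := fun g => (P g, S g)) (by fun_prop)
    (fun g g' h => by rw [hdepP g g' h, hdepS g g' h])
  have hmap : gapMeasure.map (fun g : ℕ → ℝ => g n) = expMeasure 1 :=
    (measurePreserving_eval_infinitePi (fun _ : ℕ => expMeasure 1) n).map_eq
  have h1 := (indepFun_iff_map_prod_eq_prod_map_map (by fun_prop)
    (measurable_pi_apply n).aemeasurable).1 hi
  rw [hmap] at h1
  have hm : Measurable fun z : (ℝ≥0∞ × ℝ) × ℝ => z.1.1 * F z.1.2 z.2 := by
    have : Measurable fun z : (ℝ≥0∞ × ℝ) × ℝ => F z.1.2 z.2 :=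
      hF.comp (f := fun z : (ℝ≥0∞ × ℝ) × ℝ => (z.1.2, z.2)) (by fun_prop)
    fun_prop
  have h2 := lintegral_map (μ := gapMeasure) hm
    (show Measurable fun g : ℕ → ℝ => ((P g, S g), g n) by fun_prop)
  rw [← h2, h1, lintegral_prod _ hm.aemeasurable, lintegral_map hm.lintegral_prod_right'
    (by fun_prop)]
  congr 1
  ext g
  exact lintegral_const_mul _ (hF.comp (f := fun y => (S g, y)) (by fun_prop))

theorem arrival_congr {n m : ℕ} (h : n < m) {g g' : ℕ → ℝ} (hg : ∀ i < m, g i = g' i) :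
    arrival n g = arrival n g' :=
  Finset.sum_congr rfl fun i hi => hg i (by have := Finset.mem_range.1 hi; omega)

theorem ratio_congr {n m : ℕ} (h : n + 1 < m) {g g' : ℕ → ℝ} (hg : ∀ i < m, g i = g' i) :
    ratio n g = ratio n g' := by
  rw [ratio, ratio, arrival_congr h hg, arrival_congr (by omega) hg]

/-- The ratios of consecutive points of the Poisson process up to the `n`-th point are
independent of each other and of the `n`-th point. -/
theorem lintegral_ratio_arrival (n : ℕ) {a : ℕ → ℝ → ℝ≥0∞} (ha : ∀ i, Measurable (a i))
    {f : ℝ → ℝ≥0∞} (hf : Measurable f) :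
    ∫⁻ g, (∏ i ∈ Finset.range n, a i (ratio i g)) * f (arrival n g) ∂gapMeasure =
      (∏ i ∈ Finset.range n, ∫⁻ b, ratioDensity i b * a i b) *
        ∫⁻ t, arrivalDensity n t * f t := by
  induction n generalizing f with
  | zero =>
    simp only [Finset.range_zero, Finset.prod_empty, one_mul, arrival_zero]
    rw [lintegral_eval_gapMeasure 0 hf, lintegral_expMeasure_one hf]
  | succ n ih =>
    have hF : Measurable (Function.uncurry fun t y : ℝ => a n (t / (t + y)) * f (t + y)) := by
      have := ha n
      fun_prop
    have h1 : ∀ t, ∫⁻ y, a n (t / (t + y)) * f (t + y) ∂expMeasure 1 =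
        ∫⁻ y, arrivalDensity 0 y * (a n (t / (t + y)) * f (t + y)) := fun t =>
      lintegral_expMeasure_one (hF.comp (f := fun y => (t, y)) (by fun_prop))
    have h2 : Measurable fun t => ∫⁻ y, a n (t / (t + y)) * f (t + y) ∂expMeasure 1 :=
      hF.lintegral_prod_right'
    calc _ = ∫⁻ g, (∏ i ∈ Finset.range n, a i (ratio i g)) *
          (fun t y => a n (t / (t + y)) * f (t + y)) (arrival n g) (g (n + 1)) ∂gapMeasure := by
          congr 1
          ext g
          rw [Finset.prod_range_succ, mul_assoc]
          simp only [ratio, arrival_succ]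
      _ = ∫⁻ g, (∏ i ∈ Finset.range n, a i (ratio i g)) *
          ∫⁻ y, a n (arrival n g / (arrival n g + y)) * f (arrival n g + y)
            ∂expMeasure 1 ∂gapMeasure := by
          apply lintegral_gap_indep (n + 1) _ (by fun_prop) _ _ hF
          · exact Finset.measurable_prod _ fun i _ => (ha i).comp (by fun_prop)
          · intro g g' h
            refine Finset.prod_congr rfl fun i hi => ?_
            rw [ratio_congr (by have := Finset.mem_range.1 hi; omega) h]
          · intro g g' h
            exact arrival_congr (by omega) h
      _ = _ := by
          rw [ih h2]
          simp_rw [h1]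
          rw [lintegral_arrivalDensity_mul n (ha n) hf, Finset.prod_range_succ, mul_assoc]

theorem lintegral_ratioDensity (n : ℕ) {c d : ℝ} (hc : 0 ≤ c) (hcd : c ≤ d) (hd : d ≤ 1) :
    ∫⁻ b, ratioDensity n b * {b : ℝ | c < b ^ (n + 1) ∧ b ^ (n + 1) ≤ d}.indicator 1 b =
      ENNReal.ofReal (d - c) := by
  set c' := c ^ ((n + 1 : ℕ) : ℝ)⁻¹ with hc'
  set d' := d ^ ((n + 1 : ℕ) : ℝ)⁻¹ with hd'
  have hd0 : 0 ≤ d := hc.trans hcd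
  have ec : c' ^ (n + 1) = c := Real.rpow_inv_natCast_pow hc (by omega)
  have ed : d' ^ (n + 1) = d := Real.rpow_inv_natCast_pow hd0 (by omega)
  have hc'0 : 0 ≤ c' := Real.rpow_nonneg hc _
  have hd'0 : 0 ≤ d' := Real.rpow_nonneg hd0 _
  have hcd' : c' ≤ d' := by
    rw [← ec, ← ed] at hcd
    exact (pow_le_pow_iff_left₀ hc'0 hd'0 (by omega)).1 hcd
  have hd1 : d' ≤ 1 := by
    rw [← ed] at hd
    exact (pow_le_one_iff_of_nonneg hd'0 (by omega)).1 hd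
  have h1 : ∫⁻ b, ratioDensity n b * {b : ℝ | c < b ^ (n + 1) ∧ b ^ (n + 1) ≤ d}.indicator 1 b =
      ∫⁻ b in Set.Ioc c' d', ENNReal.ofReal ((n + 1) * b ^ n) := by
    rw [← lintegral_indicator measurableSet_Ioc]
    apply lintegral_congr_ae
    have : ∀ᵐ y : ℝ, y ≠ 1 := by simp [ae_iff]
    filter_upwards [this] with b hb
    by_cases hb0 : 0 < b
    · have e1 : c < b ^ (n + 1) ↔ c' < b := by
        conv_lhs => rw [← ec]
        exact pow_lt_pow_iff_left₀ hc'0 hb0.le (by omega)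
      have e2 : b ^ (n + 1) ≤ d ↔ b ≤ d' := by
        conv_lhs => rw [← ed]
        exact pow_le_pow_iff_left₀ hb0.le hd'0 (by omega)
      simp only [Set.indicator_apply, Set.mem_ofPred_eq, Set.mem_Ioc, e1, e2, ratioDensity, hb0,
        true_and, Pi.one_apply]
      by_cases h2 : c' < b ∧ b ≤ d'
      · have : b < 1 := lt_of_le_of_ne (h2.2.trans hd1) hb
        simp [h2, this]
      · simp [h2]
    · have : ¬ c' < b := fun h => hb0 (hc'0.trans_lt h)
      simp [ratioDensity, hb0, this]
  rw [h1, ← ofReal_integral_eq_lintegral_ofReal]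
  · congr 1
    rw [← intervalIntegral.integral_of_le hcd', intervalIntegral.integral_const_mul, integral_pow,
      ec, ed]
    field_simp
  · exact (Continuous.integrableOn_Icc (by fun_prop)).mono_set Set.Ioc_subset_Icc_self
  · filter_upwards [ae_restrict_mem measurableSet_Ioc] with b hb
    have : 0 < b := hc'0.trans_lt hb.1
    simp only [Pi.zero_apply]; positivity

theorem gapMeasure_arrival (n : ℕ) {s : Set ℝ} (hs : MeasurableSet s) :
    gapMeasure {g | arrival n g ∈ s} = ∫⁻ t in s, arrivalDensity n t := by
  have h1 := lintegral_ratio_arrival n (a := fun i => {b : ℝ | 0 < b ^ (i + 1) ∧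
    b ^ (i + 1) ≤ 1}.indicator 1) (f := s.indicator 1)
    (fun i => measurable_one.indicator (by measurability)) (measurable_one.indicator hs)
  simp only [lintegral_ratioDensity _ le_rfl zero_le_one le_rfl] at h1
  simp only [sub_zero, ENNReal.ofReal_one, Finset.prod_const_one, one_mul] at h1
  change gapMeasure (arrival n ⁻¹' s) = _
  rw [← lintegral_indicator hs, ← lintegral_indicator_one (measurable_arrival n hs)]
  convert h1 using 1
  · apply lintegral_congr_ae
    filter_upwards [ae_gap_pos] with g hg
    rw [Finset.prod_eq_one, one_mul]
    · rfl
    intro i _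
    have h2 := ratio_mem_Ioo hg i
    rw [Set.indicator_of_mem, Pi.one_apply]
    exact ⟨pow_pos h2.1 _, pow_le_one₀ h2.1.le h2.2.le⟩
  · congr 1
    ext t
    by_cases ht : t ∈ s <;> simp [ht]

theorem lintegral_arrivalDensity (n : ℕ) : ∫⁻ t, arrivalDensity n t = 1 := by
  simpa using (gapMeasure_arrival n MeasurableSet.univ).symm

/-- The powers `ratio i ^ (i + 1)` are independent and uniform on the unit interval. -/
theorem gapMeasure_ratio (n : ℕ) {c d : ℕ → ℝ} (hc : ∀ i < n, 0 ≤ c i)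
    (hcd : ∀ i < n, c i ≤ d i) (hd : ∀ i < n, d i ≤ 1) :
    gapMeasure {g | ∀ i < n, c i < ratio i g ^ (i + 1) ∧ ratio i g ^ (i + 1) ≤ d i} =
      ∏ i ∈ Finset.range n, ENNReal.ofReal (d i - c i) := by
  have hm : ∀ i, MeasurableSet {b : ℝ | c i < b ^ (i + 1) ∧ b ^ (i + 1) ≤ d i} := fun i => by
    measurability
  have h1 := lintegral_ratio_arrival n (a := fun i => {b : ℝ | c i < b ^ (i + 1) ∧
    b ^ (i + 1) ≤ d i}.indicator 1) (f := 1)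
    (fun i => measurable_one.indicator (hm i)) measurable_one
  simp only [Pi.one_apply, mul_one, lintegral_arrivalDensity] at h1
  rw [Finset.prod_congr rfl fun i hi => lintegral_ratioDensity i (hc i (Finset.mem_range.1 hi))
    (hcd i (Finset.mem_range.1 hi)) (hd i (Finset.mem_range.1 hi))] at h1
  rw [← h1, ← lintegral_indicator_one]
  · congr 1
    ext g
    by_cases hg : ∀ i < n, c i < ratio i g ^ (i + 1) ∧ ratio i g ^ (i + 1) ≤ d i
    · rw [Set.indicator_of_mem (by exact hg), Finset.prod_eq_one]
      · rfl
      · intro i hi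
        rw [Set.indicator_of_mem (by exact hg i (Finset.mem_range.1 hi)), Pi.one_apply]
    · rw [Set.indicator_of_notMem (by exact hg)]
      push Not at hg
      obtain ⟨i, hi, h2⟩ := hg
      rw [Finset.prod_eq_zero (Finset.mem_range.2 hi)]
      rw [Set.indicator_of_notMem]
      rintro ⟨h3, h4⟩
      exact (h2 h3).not_ge h4
  · simp only [Set.ofPred_forall]
    exact MeasurableSet.iInter fun i => MeasurableSet.iInter fun _ => measurable_ratio i (hm i)

/-! ### The coupling -/

/-- The quantile function of the number of edges left when the first vertex is drawn, drawing
without replacement from a pool of `k` vertices and `e` edges: this number is at most `m` with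
probability `(m + k).choose k / (e + k).choose k`. -/
noncomputable def edgesLeft (k e : ℕ) (u : ℝ) : ℕ :=
  sInf {m : ℕ | m = e ∨ u * ((e + k).choose k : ℝ) ≤ ((m + k).choose k : ℝ)}

theorem edgesLeft_mem (k e : ℕ) (u : ℝ) :
    edgesLeft k e u = e ∨ u * ((e + k).choose k : ℝ) ≤ ((edgesLeft k e u + k).choose k : ℝ) :=
  Nat.sInf_mem (s := {m : ℕ | m = e ∨ u * ((e + k).choose k : ℝ) ≤ ((m + k).choose k : ℝ)})
    ⟨e, Or.inl rfl⟩

theorem lt_of_lt_edgesLeft {k e m : ℕ} {u : ℝ} (h : m < edgesLeft k e u) :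
    ((m + k).choose k : ℝ) < u * ((e + k).choose k : ℝ) := by
  have := Nat.notMem_of_lt_sInf h
  rw [Set.mem_ofPred_eq, not_or, not_le] at this
  exact this.2

theorem edgesLeft_le (k e : ℕ) (u : ℝ) : edgesLeft k e u ≤ e :=
  Nat.sInf_le (Or.inl rfl)

theorem edgesLeft_mono (k e : ℕ) : Monotone (edgesLeft k e) := by
  intro u v huv
  apply Nat.sInf_le
  rcases edgesLeft_mem k e v with h | h
  · exact Or.inl h
  · exact Or.inr ((mul_le_mul_of_nonneg_right huv (Nat.cast_nonneg _)).trans h)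

theorem edgesLeft_eq_iff {k e j : ℕ} {u : ℝ} (hk : 0 < k) (hj : j ≤ e) (hu : 0 < u)
    (hu1 : u ≤ 1) :
    edgesLeft k e u = j ↔ ((j + k - 1).choose k : ℝ) / ((e + k).choose k : ℝ) < u ∧
      u ≤ ((j + k).choose k : ℝ) / ((e + k).choose k : ℝ) := by
  have hpos : (0 : ℝ) < ((e + k).choose k : ℝ) := by exact_mod_cast Nat.choose_pos (by omega)
  rw [div_lt_iff₀ hpos, le_div_iff₀ hpos]
  constructor
  · rintro rfl
    constructor
    · rcases Nat.eq_zero_or_pos (edgesLeft k e u) with h | h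
      · rw [h, Nat.choose_eq_zero_of_lt (by omega)]
        simpa using mul_pos hu hpos
      · have := lt_of_lt_edgesLeft (show edgesLeft k e u - 1 < edgesLeft k e u by omega)
        rwa [show edgesLeft k e u - 1 + k = edgesLeft k e u + k - 1 by omega] at this
    · rcases edgesLeft_mem k e u with h | h
      · rw [h]; exact mul_le_of_le_one_left hpos.le hu1
      · exact h
  · rintro ⟨h1, h2⟩
    apply le_antisymm
    · exact Nat.sInf_le (Or.inr h2)
    · by_contra h3
      push Not at h3
      have h4 : u * ((e + k).choose k : ℝ) ≤ ((edgesLeft k e u + k).choose k : ℝ) :=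
        (edgesLeft_mem k e u).resolve_left (by omega)
      have h5 : (edgesLeft k e u + k).choose k ≤ (j + k - 1).choose k :=
        Nat.choose_le_choose k (by omega)
      have h6 : ((edgesLeft k e u + k).choose k : ℝ) ≤ ((j + k - 1).choose k : ℝ) := by
        exact_mod_cast h5
      linarith

/-- The factors `(m + i) / (e + i)` of the quotient of `(m + k).choose k` and `(e + k).choose k` are
at most the last one. -/
theorem choose_mul_pow_le {m e : ℕ} (k : ℕ) (h : m ≤ e) :
    (m + k).choose k * (e + k) ^ k ≤ (e + k).choose k * (m + k) ^ k := by
  apply Nat.le_of_mul_le_mul_left _ k.factorial_pos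
  rw [← mul_assoc, ← mul_assoc, ← Nat.ascFactorial_eq_factorial_mul_choose,
    ← Nat.ascFactorial_eq_factorial_mul_choose, Nat.ascFactorial_eq_prod_range,
    Nat.ascFactorial_eq_prod_range]
  rw [← Finset.card_range k, ← Finset.prod_const, ← Finset.prod_const, Finset.card_range,
    ← Finset.prod_mul_distrib, ← Finset.prod_mul_distrib]
  apply Finset.prod_le_prod'
  intro i hi
  obtain ⟨d, rfl⟩ := Nat.exists_eq_add_of_le h
  obtain ⟨l, rfl⟩ := Nat.exists_eq_add_of_lt (Finset.mem_range.1 hi)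
  nlinarith [Nat.zero_le (d * l)]

/-- The factors `(m + i) / (e + i)` of the quotient of `(m + k).choose k` and `(e + k).choose k` are
at least the first one. -/
theorem pow_mul_choose_le {m e : ℕ} (k : ℕ) (h : m ≤ e) :
    (m + 1) ^ k * (e + k).choose k ≤ (e + 1) ^ k * (m + k).choose k := by
  apply Nat.le_of_mul_le_mul_left _ k.factorial_pos
  rw [mul_left_comm, mul_left_comm k.factorial, ← Nat.ascFactorial_eq_factorial_mul_choose,
    ← Nat.ascFactorial_eq_factorial_mul_choose, Nat.ascFactorial_eq_prod_range,
    Nat.ascFactorial_eq_prod_range]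
  rw [← Finset.card_range k, ← Finset.prod_const, ← Finset.prod_const, Finset.card_range,
    ← Finset.prod_mul_distrib, ← Finset.prod_mul_distrib]
  apply Finset.prod_le_prod'
  intro i hi
  obtain ⟨d, rfl⟩ := Nat.exists_eq_add_of_le h
  nlinarith [Nat.zero_le (d * i)]

/-- Together with `edgesLeft_le_mul`: the quantile function of the urn is close to linear in the
variable `b`, with an error of order `k` uniformly in the number `e` of edges. -/
theorem le_edgesLeft {k e : ℕ} {b : ℝ} (hk : 0 < k) (hb : b ∈ Set.Ioo (0 : ℝ) 1) :
    e * b - k ≤ edgesLeft k e (b ^ k) := by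
  have he0 : (0 : ℝ) ≤ e := Nat.cast_nonneg _
  have hk0 : (0 : ℝ) < k := by exact_mod_cast hk
  rcases edgesLeft_mem k e (b ^ k) with h | h
  · rw [h]; nlinarith [hb.1, hb.2]
  · set m := edgesLeft k e (b ^ k)
    have h1 : ((m + k).choose k : ℝ) * (e + k) ^ k ≤ (e + k).choose k * (m + k) ^ k := by
      exact_mod_cast choose_mul_pow_le k (edgesLeft_le k e _)
    have hpos : (0 : ℝ) < ((e + k).choose k : ℝ) := by exact_mod_cast Nat.choose_pos (by omega)
    have h2 : (b * (e + k)) ^ k ≤ ((m : ℝ) + k) ^ k := by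
      apply le_of_mul_le_mul_left _ hpos
      calc _ = b ^ k * ((e + k).choose k : ℝ) * (e + k) ^ k := by rw [mul_pow]; ring
        _ ≤ _ := (mul_le_mul_of_nonneg_right h (by positivity)).trans h1
    have h3 := (pow_le_pow_iff_left₀ (mul_nonneg hb.1.le (by positivity)) (by positivity)
      hk.ne').1 h2
    nlinarith [hb.1]

theorem edgesLeft_le_mul {k e : ℕ} {b : ℝ} (hk : 0 < k) (hb : b ∈ Set.Ioo (0 : ℝ) 1) :
    (edgesLeft k e (b ^ k) : ℝ) ≤ e * b + 1 := by
  have he0 : (0 : ℝ) ≤ e := Nat.cast_nonneg _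
  rcases Nat.eq_zero_or_pos (edgesLeft k e (b ^ k)) with h | h
  · rw [h]; have := mul_nonneg he0 hb.1.le; push_cast; linarith
  · obtain ⟨m, hm⟩ := Nat.exists_eq_succ_of_ne_zero h.ne'
    have h1 := lt_of_lt_edgesLeft (show m < edgesLeft k e (b ^ k) by omega)
    have h2 : ((m : ℝ) + 1) ^ k * (e + k).choose k ≤ (e + 1) ^ k * (m + k).choose k := by
      exact_mod_cast pow_mul_choose_le k (by have := edgesLeft_le k e (b ^ k); omega)
    have hpos : (0 : ℝ) < ((e + k).choose k : ℝ) := by exact_mod_cast Nat.choose_pos (by omega)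
    have h3 : ((m : ℝ) + 1) ^ k ≤ (b * (e + 1)) ^ k := by
      apply le_of_mul_le_mul_right _ hpos
      calc _ ≤ _ := h2
        _ ≤ (e + 1) ^ k * (b ^ k * ((e + k).choose k : ℝ)) := by gcongr
        _ = _ := by rw [mul_pow]; ring
    have h4 := (pow_le_pow_iff_left₀ (by positivity) (mul_nonneg hb.1.le (by positivity))
      hk.ne').1 h3
    rw [hm]; push_cast
    nlinarith [hb.2]

/-- The edge counts of the growth process on `N` vertices, driven by the Poisson process: the
number of virtual edges left when `k` virtual vertices become `k - 1` is the quantile of the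
uniform variable `ratio (k - 1) ^ k`. -/
noncomputable def coupledEdgeCount (N : ℕ) (g : ℕ → ℝ) : ℕ → ℕ
  | 0 => 0
  | n + 1 => n.choose 2 - edgesLeft (N - n) (n.choose 2 - coupledEdgeCount N g n)
      (ratio (N - 1 - n) g ^ (N - n))

theorem coupledEdgeCount_succ (N : ℕ) (g : ℕ → ℝ) (n : ℕ) :
    coupledEdgeCount N g (n + 1) =
      n.choose 2 - edgesLeft (N - n) (n.choose 2 - coupledEdgeCount N g n)
        (ratio (N - 1 - n) g ^ (N - n)) := rfl

@[fun_prop]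
theorem measurable_coupledEdgeCount (N n : ℕ) :
    Measurable fun g => coupledEdgeCount N g n := by
  induction n with
  | zero => exact measurable_const
  | succ n ih =>
    have h1 : Measurable fun z : ℕ × ℝ => n.choose 2 - edgesLeft (N - n) (n.choose 2 - z.1) z.2 :=
      measurable_from_prod_countable_right fun m => by
        exact (measurable_from_top (f := fun l : ℕ => n.choose 2 - l)).comp
          (edgesLeft_mono (N - n) (n.choose 2 - m)).measurable
    exact h1.comp (f := fun g => (coupledEdgeCount N g n, ratio (N - 1 - n) g ^ (N - n)))
      (ih.prodMk (by fun_prop))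

theorem measurable_coupledEdgeCount_fin (N : ℕ) :
    Measurable fun g (n : Fin (N + 1)) => coupledEdgeCount N g n := by
  rw [measurable_pi_iff]; intro n; fun_prop

theorem firstVertexProb_eq {k e j : ℕ} (hk : 0 < k) (hj : j ≤ e) :
    (firstVertexProb k e j : ℝ≥0∞) = ENNReal.ofReal (((j + k).choose k : ℝ) /
      ((e + k).choose k : ℝ) - ((j + k - 1).choose k : ℝ) / ((e + k).choose k : ℝ)) := by
  obtain ⟨k, rfl⟩ := Nat.exists_eq_succ_of_ne_zero hk.ne'
  rw [firstVertexProb, if_pos hj, ← sub_div, Nat.succ_eq_add_one, ← add_assoc, Nat.add_sub_cancel,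
    Nat.add_sub_cancel, Nat.choose_succ_succ, ENNReal.ofReal, Nat.cast_add, add_sub_cancel_right,
    Real.toNNReal_div (by positivity), Real.toNNReal_natCast, Real.toNNReal_natCast, ← add_assoc]

/-- The coupled edge counts form a Markov chain with transition probabilities `stepProb`. -/
theorem gapMeasure_coupledEdgeCount {N : ℕ} (x : ℕ → ℕ) (hx : x 0 = 0) :
    gapMeasure {g | ∀ n ≤ N, coupledEdgeCount N g n = x n} =
      ((∏ n ∈ Finset.range N, stepProb N n (x n) (x (n + 1)) : ℝ≥0) : ℝ≥0∞) := by
  have hset : {g | ∀ n ≤ N, coupledEdgeCount N g n = x n} =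
      {g | ∀ n < N, n.choose 2 - edgesLeft (N - n) (n.choose 2 - x n)
        (ratio (N - 1 - n) g ^ (N - n)) = x (n + 1)} := by
    ext g
    constructor
    · intro h n hn
      rw [← h n hn.le, ← coupledEdgeCount_succ]; exact h (n + 1) hn
    · intro h n hn
      induction n with
      | zero => rw [hx]; rfl
      | succ n ih => rw [coupledEdgeCount_succ, ih (by omega)]; exact h n hn
  rw [hset]
  -- if a step is impossible both sides vanish, otherwise the event is one of independent uniforms
  by_cases hadm : ∀ n < N, x (n + 1) ≤ n.choose 2 ∧
      n.choose 2 - x (n + 1) ≤ n.choose 2 - x n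
  · set C : ℕ → ℝ := fun n => (((n.choose 2 - x (n + 1)) + (N - n) - 1).choose (N - n) : ℝ) /
      (((n.choose 2 - x n) + (N - n)).choose (N - n) : ℝ) with hC
    set D : ℕ → ℝ := fun n => (((n.choose 2 - x (n + 1)) + (N - n)).choose (N - n) : ℝ) /
      (((n.choose 2 - x n) + (N - n)).choose (N - n) : ℝ) with hD
    have hCD : ∀ n, C n ≤ D n := fun n => by
      apply div_le_div_of_nonneg_right _ (Nat.cast_nonneg _)
      exact_mod_cast Nat.choose_le_choose _ (by omega)
    have h1 : ∀ᵐ g ∂gapMeasure, g ∈ {g | ∀ n < N, n.choose 2 - edgesLeft (N - n)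
          (n.choose 2 - x n) (ratio (N - 1 - n) g ^ (N - n)) = x (n + 1)} ↔
        g ∈ {g | ∀ i < N, C (N - 1 - i) < ratio i g ^ (i + 1) ∧
          ratio i g ^ (i + 1) ≤ D (N - 1 - i)} := by
      filter_upwards [ae_gap_pos] with g hg
      have key : ∀ n < N, (n.choose 2 - edgesLeft (N - n) (n.choose 2 - x n)
          (ratio (N - 1 - n) g ^ (N - n)) = x (n + 1) ↔
          C n < ratio (N - 1 - n) g ^ (N - n) ∧ ratio (N - 1 - n) g ^ (N - n) ≤ D n) := by
        intro n hn
        have h2 := ratio_mem_Ioo hg (N - 1 - n)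
        rw [← edgesLeft_eq_iff (by omega) (hadm n hn).2 (pow_pos h2.1 _)
          (pow_le_one₀ h2.1.le h2.2.le)]
        have := edgesLeft_le (N - n) (n.choose 2 - x n) (ratio (N - 1 - n) g ^ (N - n))
        have := (hadm n hn).1
        omega
      constructor
      · intro h i hi
        have := (key (N - 1 - i) (by omega)).1 (h (N - 1 - i) (by omega))
        rwa [show N - 1 - (N - 1 - i) = i by omega, show N - (N - 1 - i) = i + 1 by omega] at this
      · intro h n hn
        rw [key n hn]
        have := h (N - 1 - n) (by omega)
        rwa [show N - 1 - (N - 1 - n) = n by omega, show N - 1 - n + 1 = N - n by omega] at this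
    rw [measure_congr (eventuallyEq_set.2 h1), gapMeasure_ratio N
      (c := fun i => C (N - 1 - i)) (d := fun i => D (N - 1 - i)),
      Finset.prod_range_reflect (fun n => ENNReal.ofReal (D n - C n)) N,
      ENNReal.ofNNReal_finsetProd]
    · refine Finset.prod_congr rfl fun n hn => ?_
      have hn := Finset.mem_range.1 hn
      rw [stepProb, if_pos (hadm n hn).1, firstVertexProb_eq (by omega) (hadm n hn).2]
    · intro i _; positivity
    · intro i _; exact hCD _
    · intro i hi
      apply div_le_one_of_le₀ _ (Nat.cast_nonneg _)
      have := (hadm (N - 1 - i) (by omega)).2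
      exact_mod_cast Nat.choose_le_choose _ (by omega)
  · push Not at hadm
    obtain ⟨n, hn, h1⟩ := hadm
    have h2 : stepProb N n (x n) (x (n + 1)) = 0 := by
      rw [stepProb]
      split_ifs with h3
      · rw [firstVertexProb, if_neg (h1 h3).not_ge]
      · rfl
    rw [Finset.prod_eq_zero (Finset.mem_range.2 hn) h2, ENNReal.coe_zero]
    convert measure_empty (μ := gapMeasure)
    rw [Set.eq_empty_iff_forall_notMem]
    intro g hg
    have h3 := hg n hn
    have h4 := h1 (by omega)
    have := edgesLeft_le (N - n) (n.choose 2 - x n) (ratio (N - 1 - n) g ^ (N - n))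
    omega

/-- The edge counts of the growth process have the same joint law as their coupled version. -/
theorem map_edgeCount_eq (N : ℕ) :
    (growthMeasure N).map (fun h (n : Fin (N + 1)) => edgeCount h n) =
      gapMeasure.map (fun g (n : Fin (N + 1)) => coupledEdgeCount N g n) := by
  have hm1 : Measurable fun (h : History N) (n : Fin (N + 1)) => edgeCount h n :=
    measurable_from_top
  have hm2 := measurable_coupledEdgeCount_fin N
  apply Measure.ext_of_singleton
  intro y
  rw [Measure.map_apply hm1 (measurableSet_singleton y),
    Measure.map_apply hm2 (measurableSet_singleton y)]
  set x : ℕ → ℕ := fun n => if hn : n < N + 1 then y ⟨n, hn⟩ else 0 with hx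
  have hiff : ∀ f : ℕ → ℕ, (fun n : Fin (N + 1) => f n) = y ↔ ∀ n ≤ N, f n = x n := by
    intro f
    constructor
    · rintro rfl n hn
      simp only [hx, dif_pos (Nat.lt_succ_iff.2 hn)]
    · intro h
      ext n
      rw [h n (Nat.lt_succ_iff.1 n.2)]
      simp only [hx, dif_pos n.2]
  have h1 : (fun (h : History N) (n : Fin (N + 1)) => edgeCount h n) ⁻¹' {y} =
      {h | ∀ n ≤ N, edgeCount h n = x n} := by
    ext h; exact hiff (edgeCount h)
  have h2 : (fun g (n : Fin (N + 1)) => coupledEdgeCount N g n) ⁻¹' {y} =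
      {g | ∀ n ≤ N, coupledEdgeCount N g n = x n} := by
    ext g; exact hiff (coupledEdgeCount N g)
  rw [h1, h2]
  by_cases h0 : x 0 = 0
  · rw [growthMeasure_edgeCount x h0, gapMeasure_coupledEdgeCount x h0]
  · have e1 : {h : History N | ∀ n ≤ N, edgeCount h n = x n} = ∅ := by
      rw [Set.eq_empty_iff_forall_notMem]
      intro h hh
      exact h0 (by rw [← hh 0 (Nat.zero_le _), edgeCount_zero])
    have e2 : {g | ∀ n ≤ N, coupledEdgeCount N g n = x n} = ∅ := by
      rw [Set.eq_empty_iff_forall_notMem]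
      intro h hh
      exact h0 (by rw [← hh 0 (Nat.zero_le _)]; rfl)
    rw [e1, e2, measure_empty, measure_empty]

/-! ### Almost sure asymptotics -/

theorem lintegral_ofReal_gap (n : ℕ) : ∫⁻ g, ENNReal.ofReal (g n) ∂gapMeasure = 1 := by
  rw [lintegral_eval_gapMeasure n ENNReal.measurable_ofReal,
    lintegral_expMeasure_one ENNReal.measurable_ofReal, ← lintegral_arrivalDensity 1]
  congr 1
  ext y
  simp only [arrivalDensity]
  split_ifs with hy
  · rw [← ENNReal.ofReal_mul (by positivity)]
    congr 1
    simp; ring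
  · simp

theorem integrable_gap (n : ℕ) : Integrable (fun g : ℕ → ℝ => g n) gapMeasure := by
  refine ⟨(measurable_pi_apply n).aestronglyMeasurable, ?_⟩
  rw [hasFiniteIntegral_iff_ofReal, lintegral_ofReal_gap]
  · exact ENNReal.one_lt_top
  · filter_upwards [ae_gap_pos] with g hg using (hg n).le

theorem integral_gap (n : ℕ) : ∫ g, g n ∂gapMeasure = 1 := by
  rw [integral_eq_lintegral_of_nonneg_ae _ (measurable_pi_apply n).aestronglyMeasurable,
    lintegral_ofReal_gap, ENNReal.toReal_one]
  filter_upwards [ae_gap_pos] with g hg using (hg n).le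

theorem ae_tendsto_arrival_div :
    ∀ᵐ g ∂gapMeasure, Tendsto (fun n : ℕ => arrival n g / (n + 1)) atTop (𝓝 1) := by
  have hi : iIndepFun (fun (i : ℕ) (g : ℕ → ℝ) => g i) gapMeasure :=
    iIndepFun_infinitePi (P := fun _ : ℕ => expMeasure 1) (X := fun _ x => x) (by fun_prop)
  have h := strong_law_ae_real (μ := gapMeasure) (fun (i : ℕ) (g : ℕ → ℝ) => g i)
    (integrable_gap 0) (fun i j hij => hi.indepFun hij) (fun i => by
      refine ⟨(measurable_pi_apply i).aemeasurable, (measurable_pi_apply 0).aemeasurable, ?_⟩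
      exact (measurePreserving_eval_infinitePi (fun _ : ℕ => expMeasure 1) i).map_eq.trans
        (measurePreserving_eval_infinitePi (fun _ : ℕ => expMeasure 1) 0).map_eq.symm)
  filter_upwards [h] with g hg
  rw [integral_gap] at hg
  have := hg.comp (tendsto_add_atTop_nat 1)
  simpa [Function.comp_def, arrival] using this

/-- If `a n ~ n`, then the sums of the reciprocals grow like the harmonic numbers. -/
theorem tendsto_sum_inv_div_log {a : ℕ → ℝ}
    (ha : Tendsto (fun n : ℕ => a n / (n + 1)) atTop (𝓝 1)) :
    Tendsto (fun N : ℕ => (∑ i ∈ Finset.range N, (a i)⁻¹) / Real.log N) atTop (𝓝 1) := by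
  have hlog : Tendsto (fun N : ℕ => Real.log N) atTop atTop :=
    Real.tendsto_log_atTop.comp tendsto_natCast_atTop_atTop
  have hH : ∀ N : ℕ, ∑ i ∈ Finset.range N, ((i : ℝ) + 1)⁻¹ = (harmonic N : ℝ) := by
    intro N; simp [harmonic]
  have h1 : Tendsto (fun N : ℕ => (harmonic N : ℝ) / Real.log N) atTop (𝓝 1) := by
    have h2 := (Real.tendsto_harmonic_sub_log.div_atTop hlog).add_const 1
    rw [zero_add] at h2
    refine h2.congr' ?_
    filter_upwards [hlog.eventually_gt_atTop 0] with N hN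
    field_simp; ring
  have hHtop : Tendsto (fun N : ℕ => (harmonic N : ℝ)) atTop atTop := by
    have h2 := Real.tendsto_harmonic_sub_log.add_atTop hlog
    simpa using h2
  have h3 : (fun i : ℕ => (a i)⁻¹ - ((i : ℝ) + 1)⁻¹) =o[atTop] fun i : ℕ => ((i : ℝ) + 1)⁻¹ := by
    rw [Asymptotics.isLittleO_iff_tendsto' (Eventually.of_forall fun i h => by
      exact absurd h (by positivity))]
    have h4 := (ha.inv₀ one_ne_zero).sub_const 1
    rw [inv_one, sub_self] at h4
    refine h4.congr fun i => ?_
    have : (i : ℝ) + 1 ≠ 0 := by positivity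
    rw [inv_div, sub_div, div_self (by positivity)]
    simp [div_eq_mul_inv, mul_comm]
  have h5 := h3.sum_range (fun i => by simp only [Pi.zero_apply]; positivity) (by simpa only [hH])
  simp only [Finset.sum_sub_distrib, hH] at h5
  have h6 := h5.tendsto_div_nhds_zero.mul h1
  have h7 := h6.add h1
  rw [zero_mul, zero_add] at h7
  refine h7.congr' ?_
  filter_upwards [hHtop.eventually_gt_atTop 0, hlog.eventually_gt_atTop 0] with N h8 h9
  field_simp; ring

theorem exists_abs_div_le {a : ℕ → ℝ} (ha : Tendsto (fun n : ℕ => a n / (n + 1)) atTop (𝓝 1)) :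
    ∃ C : ℝ, 0 ≤ C ∧ ∀ n : ℕ, |((n : ℝ) + 1) / a n| ≤ C := by
  have h1 := (ha.inv₀ one_ne_zero)
  simp only [inv_div] at h1
  obtain ⟨C, hC⟩ := h1.abs.bddAbove_range
  exact ⟨C, (abs_nonneg _).trans (hC ⟨0, rfl⟩), fun n => hC ⟨n, rfl⟩⟩

theorem coupledEdgeCount_le (N : ℕ) (g : ℕ → ℝ) (n : ℕ) :
    coupledEdgeCount N g n ≤ (n - 1).choose 2 := by
  cases n with
  | zero => simp [coupledEdgeCount]
  | succ n => rw [coupledEdgeCount_succ]; exact Nat.sub_le _ _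

theorem coupledEdgeCount_mono (N : ℕ) (g : ℕ → ℝ) : Monotone (coupledEdgeCount N g) := by
  apply monotone_nat_of_le_succ
  intro n
  have h1 := coupledEdgeCount_le N g n
  have h2 := Nat.choose_le_choose 2 (Nat.sub_le n 1)
  have h3 := edgesLeft_le (N - n) (n.choose 2 - coupledEdgeCount N g n)
      (ratio (N - 1 - n) g ^ (N - n))
  rw [coupledEdgeCount_succ]
  omega

/-- The number of virtual edges just after the `n`-th vertex becomes occupied, in the coupling. -/
noncomputable def coupledVirtual (N : ℕ) (g : ℕ → ℝ) (n : ℕ) : ℕ :=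
  n.choose 2 - coupledEdgeCount N g n

theorem coupledVirtual_succ (N : ℕ) (g : ℕ → ℝ) (n : ℕ) :
    coupledVirtual N g (n + 1) =
      n + edgesLeft (N - n) (coupledVirtual N g n) (ratio (N - 1 - n) g ^ (N - n)) := by
  have h1 := edgesLeft_le (N - n) (coupledVirtual N g n) (ratio (N - 1 - n) g ^ (N - n))
  have h2 : (n + 1).choose 2 = n + n.choose 2 := by
    rw [Nat.choose_succ_succ' n 1, Nat.choose_one_right]
  rw [coupledVirtual, coupledEdgeCount_succ, h2]
  rw [coupledVirtual] at h1 ⊢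
  omega

/-- In terms of the number `j` of virtual vertices, the number of virtual edges is, up to an error
of order `j`, a linear recursion with coefficients `ratio j`; dividing by the points of the Poisson
process turns it into a sum. -/
theorem abs_coupledVirtual_step {N : ℕ} {g : ℕ → ℝ} (hg : ∀ n, 0 < g n) {j : ℕ} (hj : j < N) :
    |(coupledVirtual N g (N - j) : ℝ) / arrival j g -
        (coupledVirtual N g (N - (j + 1)) : ℝ) / arrival (j + 1) g - N * (arrival j g)⁻¹| ≤
      2 * |((j : ℝ) + 1) / arrival j g| := by
  have ha := arrival_pos hg j
  have ha' := arrival_pos hg (j + 1)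
  have hr := ratio_mem_Ioo hg j
  obtain ⟨n, rfl⟩ := Nat.exists_eq_add_of_lt hj
  rw [show j + n + 1 - j = n + 1 by omega, show j + n + 1 - (j + 1) = n by omega,
    coupledVirtual_succ]
  rw [show j + n + 1 - 1 - n = j by omega, show j + n + 1 - n = j + 1 by omega]
  set e := coupledVirtual (j + n + 1) g n
  have h1 := le_edgesLeft (k := j + 1) (e := e) (by omega) hr
  have h2 := edgesLeft_le_mul (k := j + 1) (e := e) (by omega) hr
  set G := edgesLeft (j + 1) e (ratio j g ^ (j + 1))
  have h3 : (e : ℝ) / arrival (j + 1) g = e * ratio j g / arrival j g := by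
    rw [ratio]; field_simp
  rw [h3, inv_eq_one_div, mul_one_div, ← sub_div, ← sub_div, abs_div, abs_div, ← mul_div_assoc]
  apply div_le_div_of_nonneg_right _ (abs_nonneg _)
  rw [abs_of_pos (by positivity : (0 : ℝ) < (j : ℝ) + 1), abs_le]
  push_cast at h1 h2 ⊢
  have : (0 : ℝ) ≤ j := Nat.cast_nonneg _
  constructor <;> linarith

/-- After rescaling by `N log N`, the number of virtual edges present when `j` vertices are virtual
converges to the `j`-th point of the Poisson process. -/
theorem tendsto_coupledVirtual {g : ℕ → ℝ} (hg : ∀ n, 0 < g n)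
    (hlim : Tendsto (fun n : ℕ => arrival n g / (n + 1)) atTop (𝓝 1)) (j : ℕ) :
    Tendsto (fun N : ℕ => (coupledVirtual N g (N - j) : ℝ) / (N * Real.log N)) atTop
      (𝓝 (arrival j g)) := by
  have hlog : Tendsto (fun N : ℕ => Real.log N) atTop atTop :=
    Real.tendsto_log_atTop.comp tendsto_natCast_atTop_atTop
  obtain ⟨C, hC0, hC⟩ := exists_abs_div_le hlim
  have ha := arrival_pos hg j
  -- telescoping the recursion
  have h1 : ∀ N l : ℕ, j + l ≤ N → |(coupledVirtual N g (N - j) : ℝ) / arrival j g -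
      (coupledVirtual N g (N - (j + l)) : ℝ) / arrival (j + l) g -
        N * ∑ i ∈ Finset.range l, (arrival (j + i) g)⁻¹| ≤ 2 * C * l := by
    intro N l hl
    induction l with
    | zero => simp
    | succ l ih =>
      have h2 := ih (by omega)
      have h3 := (abs_coupledVirtual_step hg (show j + l < N by omega)).trans
        (mul_le_mul_of_nonneg_left (hC _) zero_le_two)
      rw [Finset.sum_range_succ, mul_add]
      rw [abs_le] at h2 h3 ⊢
      rw [add_assoc] at h3
      push_cast
      constructor <;> linarith [h2.1, h2.2, h3.1, h3.2]
  have h2 : ∀ N : ℕ, j ≤ N → |(coupledVirtual N g (N - j) : ℝ) / arrival j g -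
        N * (∑ i ∈ Finset.range N, (arrival i g)⁻¹ - ∑ i ∈ Finset.range j, (arrival i g)⁻¹)| ≤
      2 * C * N := by
    intro N hN
    have h3 := h1 N (N - j) (by omega)
    rw [show N - (j + (N - j)) = 0 by omega] at h3
    have h4 : coupledVirtual N g 0 = 0 := by simp [coupledVirtual]
    rw [h4, Nat.cast_zero, zero_div, sub_zero] at h3
    have h5 : ∑ i ∈ Finset.range N, (arrival i g)⁻¹ - ∑ i ∈ Finset.range j, (arrival i g)⁻¹ =
        ∑ i ∈ Finset.range (N - j), (arrival (j + i) g)⁻¹ := by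
      rw [sub_eq_iff_eq_add', ← Finset.sum_range_add]
      congr 2; omega
    rw [h5]
    refine h3.trans ?_
    gcongr
    exact Nat.sub_le _ _
  have h3 : Tendsto (fun N : ℕ => (∑ i ∈ Finset.range N, (arrival i g)⁻¹ -
      ∑ i ∈ Finset.range j, (arrival i g)⁻¹) / Real.log N) atTop (𝓝 1) := by
    have := (tendsto_sum_inv_div_log hlim).sub
      (tendsto_const_nhds (x := ∑ i ∈ Finset.range j, (arrival i g)⁻¹).div_atTop hlog)
    simpa [sub_div] using this
  have h4 : Tendsto (fun N : ℕ => (coupledVirtual N g (N - j) : ℝ) / arrival j g /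
      (N * Real.log N) - (∑ i ∈ Finset.range N, (arrival i g)⁻¹ -
      ∑ i ∈ Finset.range j, (arrival i g)⁻¹) / Real.log N) atTop (𝓝 0) := by
    refine squeeze_zero_norm' ?_ (tendsto_const_nhds (x := 2 * C).div_atTop hlog)
    filter_upwards [eventually_ge_atTop j, eventually_gt_atTop 0, hlog.eventually_gt_atTop 0]
      with N hN hN0 hl
    have hN0' : (0 : ℝ) < N := by exact_mod_cast hN0
    have h5 := h2 N hN
    rw [Real.norm_eq_abs, ← mul_div_mul_left _ (Real.log N) hN0'.ne', ← sub_div, abs_div,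
      abs_of_pos (mul_pos hN0' hl)]
    refine (div_le_div_of_nonneg_right h5 (mul_pos hN0' hl).le).trans (le_of_eq ?_)
    field_simp
  have h5 := ((h4.add h3).const_mul (arrival j g))
  rw [zero_add, mul_one] at h5
  refine h5.congr fun N => ?_
  rw [sub_add_cancel]
  field_simp

/-- The rescaled atoms of the coupled process converge to the points of the Poisson process. -/
theorem tendsto_coupled_atom {g : ℕ → ℝ} (hg : ∀ n, 0 < g n)
    (hlim : Tendsto (fun n : ℕ => arrival n g / (n + 1)) atTop (𝓝 1)) (j : ℕ) :
    Tendsto (fun N : ℕ => ((N.choose 2 : ℝ) - (coupledEdgeCount N g (N - j) : ℝ)) /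
      (N * Real.log N)) atTop (𝓝 (arrival j g)) := by
  have hlog : Tendsto (fun N : ℕ => Real.log N) atTop atTop :=
    Real.tendsto_log_atTop.comp tendsto_natCast_atTop_atTop
  -- at most `j * N` edges have a virtual endpoint
  have hch : ∀ m l : ℕ, (m + l).choose 2 ≤ m.choose 2 + l * (m + l) := by
    intro m l
    induction l with
    | zero => simp
    | succ l ih =>
      rw [← add_assoc, Nat.choose_succ_succ' (m + l) 1, Nat.choose_one_right]
      nlinarith
  have h1 : Tendsto (fun N : ℕ => ((N.choose 2 : ℝ) - ((N - j).choose 2 : ℝ)) /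
      (N * Real.log N)) atTop (𝓝 0) := by
    refine squeeze_zero_norm' ?_ (tendsto_const_nhds (x := (j : ℝ)).div_atTop hlog)
    filter_upwards [eventually_ge_atTop j, eventually_gt_atTop 0, hlog.eventually_gt_atTop 0]
      with N hN hN0 hl
    have hN0' : (0 : ℝ) < N := by exact_mod_cast hN0
    have h2 := hch (N - j) j
    rw [Nat.sub_add_cancel hN] at h2
    have h2' : (N.choose 2 : ℝ) ≤ ((N - j).choose 2 : ℝ) + j * N := by exact_mod_cast h2
    have h3 : ((N - j).choose 2 : ℝ) ≤ (N.choose 2 : ℝ) := by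
      exact_mod_cast Nat.choose_le_choose 2 (Nat.sub_le N j)
    rw [Real.norm_eq_abs, abs_of_nonneg (div_nonneg (by linarith) (mul_pos hN0' hl).le),
      div_le_div_iff₀ (mul_pos hN0' hl) hl]
    nlinarith
  have h2 := (tendsto_coupledVirtual hg hlim j).add h1
  rw [add_zero] at h2
  refine h2.congr fun N => ?_
  have h3 : coupledEdgeCount N g (N - j) ≤ (N - j).choose 2 :=
    (coupledEdgeCount_le N g _).trans (Nat.choose_le_choose 2 (Nat.sub_le _ 1))
  rw [coupledVirtual, Nat.cast_sub h3, ← add_div]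
  congr 1; ring

/-! ### Vague convergence of ordered point configurations -/

theorem LocFinMeasure.tendsto_iff {α : Type*} {l : Filter α} {μ : α → LocFinMeasure}
    {ν : LocFinMeasure} :
    Tendsto μ l (𝓝 ν) ↔ ∀ f : C_c(ℝ, ℝ),
      Tendsto (fun i => ∫ x, f x ∂(μ i).toMeasure) l (𝓝 (∫ x, f x ∂ν.toMeasure)) := by
  rw [nhds_induced, tendsto_comap_iff, tendsto_pi_nhds]
  rfl

theorem exists_forall_lt_eq_zero (f : C_c(ℝ, ℝ)) : ∃ L : ℝ, ∀ x, L < x → f x = 0 := by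
  obtain ⟨L, hL⟩ := f.hasCompactSupport.isCompact.bddAbove
  refine ⟨L, fun x hx => ?_⟩
  by_contra h
  exact (hL (subset_tsupport _ h)).not_gt hx

theorem integral_sum_dirac {ι : Type} [Countable ι] (a : ι → ℝ)
    [IsLocallyFiniteMeasure (Measure.sum fun i => Measure.dirac (a i))] (f : C_c(ℝ, ℝ)) :
    ∫ x, f x ∂(Measure.sum fun i => Measure.dirac (a i)) = ∑' i, f (a i) := by
  rw [integral_sum_measure]
  · simp only [integral_dirac]
  · exact f.continuous.integrable_of_hasCompactSupport f.hasCompactSupport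

theorem isLocallyFiniteMeasure_sum_dirac {a : ℕ → ℝ} (ha : Tendsto a atTop atTop) :
    IsLocallyFiniteMeasure (Measure.sum fun i => Measure.dirac (a i)) := by
  refine ⟨fun x => ⟨Set.Iio (x + 1), Iio_mem_nhds (by linarith), ?_⟩⟩
  obtain ⟨K, hK⟩ := eventually_atTop.1 (ha.eventually_ge_atTop (x + 1))
  rw [Measure.sum_apply _ measurableSet_Iio, tsum_eq_sum (s := Finset.range K)]
  · exact ENNReal.sum_lt_top.2 fun i _ => measure_lt_top _ _
  · intro i hi
    rw [Measure.dirac_apply' _ measurableSet_Iio, Set.indicator_of_notMem]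
    simpa using hK i (by simpa using hi)

/-- The integral of a function supported in `(-∞, L]` with respect to an ordered point
configuration only involves the atoms before the first one beyond `L`. -/
theorem integral_pointConfig_nat {a : ℕ → ℝ} (ham : Monotone a) (ha : Tendsto a atTop atTop)
    (f : C_c(ℝ, ℝ)) {L : ℝ} (hf : ∀ x, L < x → f x = 0) {K : ℕ} (hK : L < a K) :
    ∫ x, f x ∂(pointConfig a).toMeasure = ∑ k ∈ Finset.range K, f (a k) := by
  have hfin := isLocallyFiniteMeasure_sum_dirac ha
  rw [pointConfig, dif_pos hfin, integral_sum_dirac, tsum_eq_sum]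
  intro k hk
  exact hf _ (hK.trans_le (ham (by simpa using hk)))

theorem integral_pointConfig_fin {a : ℕ → ℝ} (ham : Monotone a) {N : ℕ}
    (f : C_c(ℝ, ℝ)) {L : ℝ} (hf : ∀ x, L < x → f x = 0) {K : ℕ} (hK : L < a K) (hKN : K ≤ N) :
    ∫ x, f x ∂(pointConfig fun k : Fin N => a k).toMeasure = ∑ k ∈ Finset.range K, f (a k) := by
  have hfin : IsLocallyFiniteMeasure (Measure.sum fun k : Fin N => Measure.dirac (a k)) := by
    rw [Measure.sum_fintype]; infer_instance
  rw [pointConfig_of_finite, integral_sum_dirac, tsum_fintype,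
    Fin.sum_univ_eq_sum_range (fun k => f (a k)) N]
  symm
  apply Finset.sum_subset (Finset.range_subset_range.2 hKN)
  intro k _ hk
  exact hf _ (hK.trans_le (ham (by simpa using hk)))

/-- Vague convergence follows from the convergence of each atom, if integrals only involve the
atoms before the first one beyond the support of the integrand. -/
theorem tendsto_of_integral_eq_sum {α : Type*} {l : Filter α} {μ : α → LocFinMeasure}
    {ν : LocFinMeasure} {a : α → ℕ → ℝ} {b : ℕ → ℝ} (hb : Tendsto b atTop atTop)
    (hab : ∀ k, Tendsto (fun i => a i k) l (𝓝 (b k)))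
    (hμ : ∀ K, ∀ᶠ i in l, ∀ (f : C_c(ℝ, ℝ)) (L : ℝ), (∀ x, L < x → f x = 0) → L < a i K →
      ∫ x, f x ∂(μ i).toMeasure = ∑ k ∈ Finset.range K, f (a i k))
    (hν : ∀ (K : ℕ) (f : C_c(ℝ, ℝ)) (L : ℝ), (∀ x, L < x → f x = 0) → L < b K →
      ∫ x, f x ∂ν.toMeasure = ∑ k ∈ Finset.range K, f (b k)) :
    Tendsto μ l (𝓝 ν) := by
  rw [LocFinMeasure.tendsto_iff]
  intro f
  obtain ⟨L, hL⟩ := exists_forall_lt_eq_zero f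
  obtain ⟨K, hK⟩ := (hb.eventually_gt_atTop L).exists
  rw [hν K f L hL hK]
  have h1 : Tendsto (fun i => ∑ k ∈ Finset.range K, f (a i k)) l
      (𝓝 (∑ k ∈ Finset.range K, f (b k))) :=
    tendsto_finsetSum _ fun k _ => (f.continuous.tendsto _).comp (hab k)
  refine h1.congr' ?_
  filter_upwards [hμ K, (hab K).eventually_const_lt hK] with i h2 h3
  exact (h2 f L hL h3).symm

/-! ### Convergence of the point process -/

theorem arrival_monotone {g : ℕ → ℝ} (hg : ∀ n, 0 < g n) : Monotone fun k => arrival k g :=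
  monotone_nat_of_le_succ fun n => by rw [arrival_succ]; linarith [hg (n + 1)]

theorem tendsto_arrival_atTop {g : ℕ → ℝ}
    (hlim : Tendsto (fun n : ℕ => arrival n g / (n + 1)) atTop (𝓝 1)) :
    Tendsto (fun k => arrival k g) atTop atTop := by
  have h1 : Tendsto (fun n : ℕ => (n : ℝ) + 1) atTop atTop :=
    tendsto_atTop_add_const_right _ _ tendsto_natCast_atTop_atTop
  refine (hlim.pos_mul_atTop one_pos h1).congr fun n => ?_
  field_simp

/-- The Poisson process depends measurably on its spacings, since it is a continuous function of
them wherever they are positive with divergent sum. -/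
theorem aemeasurable_poissonProcess : AEMeasurable poissonProcess gapMeasure := by
  set S : Set (ℕ → ℝ) := {g | (∀ n, 0 < g n) ∧ ∀ M : ℕ, ∃ n, (M : ℝ) ≤ arrival n g} with hS
  have hSm : MeasurableSet S := by
    have e : S = (⋂ n, {g | 0 < g n}) ∩ ⋂ M : ℕ, ⋃ n, {g | (M : ℝ) ≤ arrival n g} := by
      ext g; simp [hS]
    rw [e]
    refine (MeasurableSet.iInter fun n => ?_).inter
      (MeasurableSet.iInter fun M => MeasurableSet.iUnion fun n => ?_)
    · exact measurableSet_lt measurable_const (measurable_pi_apply n)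
    · exact measurableSet_le measurable_const (measurable_arrival n)
  have hStop : ∀ g ∈ S, Tendsto (fun k => arrival k g) atTop atTop := by
    intro g hg
    refine tendsto_atTop_atTop_of_monotone (arrival_monotone hg.1) fun y => ?_
    obtain ⟨n, hn⟩ := hg.2 ⌈y⌉₊
    exact ⟨n, (Nat.le_ceil y).trans hn⟩
  have hcont : ContinuousOn poissonProcess S := by
    intro g hg
    apply tendsto_of_integral_eq_sum (hStop g hg) (a := fun g k => arrival k g)
    · intro k
      have : Continuous (arrival k) := by unfold arrival; fun_prop
      exact this.continuousWithinAt
    · intro K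
      filter_upwards [self_mem_nhdsWithin] with g' hg' f L hf hL
      exact integral_pointConfig_nat (arrival_monotone hg'.1) (hStop g' hg') f hf hL
    · intro K f L hf hL
      exact integral_pointConfig_nat (arrival_monotone hg.1) (hStop g hg) f hf hL
  have h1 := hcont.aemeasurable hSm (μ := gapMeasure)
  rwa [Measure.restrict_eq_self_of_ae_mem] at h1
  filter_upwards [ae_gap_pos, ae_tendsto_arrival_div] with g hg hlim
  exact ⟨hg, fun M => ((tendsto_arrival_atTop hlim).eventually_ge_atTop (M : ℝ)).exists⟩

/-- The rescaled atoms as a function of the edge counts. -/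
noncomputable def configOfCounts (N : ℕ) (y : Fin (N + 1) → ℕ) : LocFinMeasure :=
  pointConfig fun k : Fin N =>
    ((N.choose 2 : ℝ) - (y ⟨N - k, by omega⟩ : ℝ)) / ((N : ℝ) * Real.log N)

theorem map_reversedProcess (N : ℕ) :
    (growthMeasure N).map (reversedProcess N) =
      gapMeasure.map fun g => configOfCounts N fun n => coupledEdgeCount N g n := by
  have hm : Measurable (configOfCounts N) := measurable_of_countable _
  have hm1 : Measurable fun (h : History N) (n : Fin (N + 1)) => edgeCount h n :=
    measurable_from_top
  have hm2 := measurable_coupledEdgeCount_fin N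
  have h1 := congrArg (Measure.map (configOfCounts N)) (map_edgeCount_eq N)
  rwa [Measure.map_map hm hm1, Measure.map_map hm hm2] at h1

theorem tendstoInDistribution_coupled :
    TendstoInDistribution
      (fun (N : ℕ) g => configOfCounts N fun n => coupledEdgeCount N g n) atTop
      poissonProcess (fun _ => gapMeasure) gapMeasure := by
  apply tendstoInDistribution_of_ae_tendsto
  · intro N
    exact ((measurable_of_countable (configOfCounts N)).comp
      (measurable_coupledEdgeCount_fin N)).aemeasurable
  · exact aemeasurable_poissonProcess
  · filter_upwards [ae_gap_pos, ae_tendsto_arrival_div] with g hg hlim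
    have htop := tendsto_arrival_atTop hlim
    set a : ℕ → ℕ → ℝ := fun N k =>
      ((N.choose 2 : ℝ) - (coupledEdgeCount N g (N - k) : ℝ)) / ((N : ℝ) * Real.log N) with ha
    have ham : ∀ N, Monotone (a N) := by
      intro N k k' hk
      apply div_le_div_of_nonneg_right
      · have : (coupledEdgeCount N g (N - k') : ℝ) ≤ coupledEdgeCount N g (N - k) := by
          exact_mod_cast coupledEdgeCount_mono N g (by omega)
        linarith
      · exact mul_nonneg (Nat.cast_nonneg _) (Real.log_natCast_nonneg _)
    apply tendsto_of_integral_eq_sum htop (a := a)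
    · exact tendsto_coupled_atom hg hlim
    · intro K
      filter_upwards [eventually_ge_atTop K] with N hN f L hf hL
      exact integral_pointConfig_fin (ham N) f hf hL hN
    · intro K f L hf hL
      exact integral_pointConfig_nat (arrival_monotone hg) htop f hf hL

theorem tendstoInDistribution_reversedProcess :
    TendstoInDistribution (fun N : ℕ => reversedProcess N) atTop
        poissonProcess (fun N : ℕ => growthMeasure N) gapMeasure where
  forall_aemeasurable _ := measurable_from_top.aemeasurable
  aemeasurable_limit := aemeasurable_poissonProcess
  tendsto := by
    refine tendstoInDistribution_coupled.tendsto.congr fun N => ?_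
    exact Subtype.ext (map_reversedProcess N).symm

/-! ### The number of virtual vertices -/

theorem growthMeasure_edgeCount_mem (N : ℕ) {n : ℕ} (hn : n ≤ N) (s : Set ℕ) :
    growthMeasure N {h | edgeCount h n ∈ s} = gapMeasure {g | coupledEdgeCount N g n ∈ s} := by
  have hm1 : Measurable fun (h : History N) (n : Fin (N + 1)) => edgeCount h n :=
    measurable_from_top
  have hm2 := measurable_coupledEdgeCount_fin N
  have hs : MeasurableSet {y : Fin (N + 1) → ℕ | y ⟨n, Nat.lt_succ_of_le hn⟩ ∈ s} :=
    measurable_pi_apply _ (MeasurableSet.of_discrete (s := s))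
  have h1 := congrArg (fun μ : Measure (Fin (N + 1) → ℕ) =>
    μ {y : Fin (N + 1) → ℕ | y ⟨n, Nat.lt_succ_of_le hn⟩ ∈ s}) (map_edgeCount_eq N)
  simp only [Measure.map_apply hm1 hs, Measure.map_apply hm2 hs] at h1
  exact h1

/-- The tail of the Gamma distribution is, up to sign, an antiderivative of its density. -/
theorem hasDerivAt_arrival_tail (n : ℕ) (t : ℝ) :
    HasDerivAt (fun t : ℝ => -(Real.exp (-t) * ∑ i ∈ Finset.range (n + 1), t ^ i / i.factorial))
      (t ^ n / n.factorial * Real.exp (-t)) t := by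
  induction n with
  | zero =>
    have : HasDerivAt (fun t : ℝ => -Real.exp (-t)) (-(Real.exp (-t) * -1)) t :=
      (hasDerivAt_neg t).exp.neg
    simpa using this
  | succ n ih =>
    have h1 : HasDerivAt (fun t : ℝ => t ^ (n + 1) / ((n + 1).factorial : ℝ))
        (t ^ n / (n.factorial : ℝ)) t := by
      refine ((hasDerivAt_pow (n + 1) t).div_const ((n + 1).factorial : ℝ)).congr_deriv ?_
      rw [Nat.factorial_succ]
      push_cast
      have : (n.factorial : ℝ) ≠ 0 := by exact_mod_cast n.factorial_ne_zero
      field_simp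
    have h2 : (fun t : ℝ =>
        -(Real.exp (-t) * ∑ i ∈ Finset.range (n + 1 + 1), t ^ i / (i.factorial : ℝ))) =
        fun t => -(Real.exp (-t) * ∑ i ∈ Finset.range (n + 1), t ^ i / (i.factorial : ℝ)) -
          Real.exp (-t) * (t ^ (n + 1) / ((n + 1).factorial : ℝ)) := by
      ext t
      rw [Finset.sum_range_succ _ (n + 1)]; ring
    rw [h2]
    exact (ih.sub ((hasDerivAt_neg t).exp.mul h1)).congr_deriv (by ring)

theorem gapMeasure_arrival_lt (n : ℕ) {x : ℝ} (hx : 0 < x) :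
    gapMeasure.real {g | arrival n g < x} =
      1 - Real.exp (-x) * ∑ i ∈ Finset.range (n + 1), x ^ i / i.factorial := by
  have h1 := gapMeasure_arrival n (s := Set.Iio x) measurableSet_Iio
  have h2 : ∫⁻ t in Set.Iio x, arrivalDensity n t =
      ∫⁻ t in Set.Ioc 0 x, ENNReal.ofReal (t ^ n / n.factorial * Real.exp (-t)) := by
    rw [← lintegral_indicator measurableSet_Iio, ← lintegral_indicator measurableSet_Ioc]
    apply lintegral_congr_ae
    have : ∀ᵐ y : ℝ, y ≠ x := by simp [ae_iff]
    filter_upwards [this] with t ht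
    simp only [Set.indicator_apply, Set.mem_Iio, Set.mem_Ioc, arrivalDensity, le_iff_lt_or_eq, ht,
      or_false]
    by_cases h3 : t < x <;> by_cases h4 : 0 < t <;> simp [h3, h4]
  have hc : Continuous fun t : ℝ => t ^ n / n.factorial * Real.exp (-t) := by fun_prop
  rw [h2, ← ofReal_integral_eq_lintegral_ofReal, ← intervalIntegral.integral_of_le hx.le,
    intervalIntegral.integral_eq_sub_of_hasDerivAt (fun t _ => hasDerivAt_arrival_tail n t)
      (hc.intervalIntegrable _ _)] at h1
  · rw [measureReal_def]
    change (gapMeasure {g | arrival n g ∈ Set.Iio x}).toReal = _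
    have h0 : ∑ i ∈ Finset.range (n + 1), (0 : ℝ) ^ i / i.factorial = 1 := by
      rw [Finset.sum_eq_single 0]
      · simp
      · intro i _ hi; simp [hi]
      · simp
    rw [h1, h0, ENNReal.toReal_ofReal]
    · simp; ring
    · have h3 := Real.sum_le_exp_of_nonneg hx.le (n + 1)
      have h4 := mul_le_mul_of_nonneg_left h3 (Real.exp_pos (-x)).le
      rw [← Real.exp_add, neg_add_cancel, Real.exp_zero] at h4
      simpa using h4
  · exact hc.integrableOn_Icc.mono_set Set.Ioc_subset_Icc_self
  · filter_upwards [ae_restrict_mem measurableSet_Ioc] with t ht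
    have := ht.1
    simp only [Pi.zero_apply]; positivity

theorem gapMeasure_le_arrival (n : ℕ) {x : ℝ} (hx : 0 < x) :
    gapMeasure.real {g | x ≤ arrival n g} =
      Real.exp (-x) * ∑ i ∈ Finset.range (n + 1), x ^ i / i.factorial := by
  have h1 : {g | x ≤ arrival n g} = {g | arrival n g < x}ᶜ := by ext g; simp
  rw [h1, probReal_compl_eq_one_sub, gapMeasure_arrival_lt n hx]
  · ring
  · exact measurableSet_lt (measurable_arrival n) measurable_const

theorem ae_arrival_ne (n : ℕ) (x : ℝ) : ∀ᵐ g ∂gapMeasure, arrival n g ≠ x := by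
  rw [ae_iff]
  simp only [ne_eq, not_not]
  have h1 := gapMeasure_arrival n (measurableSet_singleton x)
  simpa using h1

theorem eventually_floor_le_totalElements (x : ℝ) :
    ∀ᶠ N : ℕ in atTop, ⌊x * (N : ℝ) * Real.log N⌋₊ ≤ totalElements N := by
  have h1 : Tendsto (fun N : ℕ => x * (Real.log N / N)) atTop (𝓝 0) := by
    have h2 := (Real.isLittleO_log_id_atTop.tendsto_div_nhds_zero.comp
      tendsto_natCast_atTop_atTop).const_mul x
    simpa [Function.comp_def] using h2
  filter_upwards [h1.eventually_lt_const (show (0 : ℝ) < 1 / 2 by norm_num),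
    eventually_gt_atTop 0] with N h2 h3
  have hN : (0 : ℝ) < N := by exact_mod_cast h3
  apply Nat.floor_le_of_le
  rw [← mul_div_assoc, div_lt_iff₀ hN] at h2
  rw [totalElements, Nat.cast_add, Nat.cast_choose_two]
  nlinarith

theorem tendsto_card_virtualVertices_le {x : ℝ} (hx : 0 < x) (k : ℕ) :
    Tendsto (fun N : ℕ => (growthMeasure N).real
      {h | (virtualVertices (h.take
        (totalElements N - ⌊x * (N : ℝ) * Real.log N⌋₊))).card ≤ k})
      atTop (𝓝 (Real.exp (-x) * ∑ i ∈ Finset.range (k + 1), x ^ i / i.factorial)) := by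
  have hlog : Tendsto (fun N : ℕ => Real.log N) atTop atTop :=
    Real.tendsto_log_atTop.comp tendsto_natCast_atTop_atTop
  have hNlog : Tendsto (fun N : ℕ => (N : ℝ) * Real.log N) atTop atTop :=
    tendsto_natCast_atTop_atTop.atTop_mul_atTop₀ hlog
  set R : ℕ → ℕ := fun N => ⌊x * (N : ℝ) * Real.log N⌋₊ with hR
  have hRlim : Tendsto (fun N : ℕ => ((R N : ℝ) - k) / (N * Real.log N)) atTop (𝓝 x) := by
    have h1 := ((tendsto_nat_floor_mul_div_atTop hx.le).comp hNlog).sub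
      (tendsto_const_nhds (x := (k : ℝ)).div_atTop hNlog)
    rw [sub_zero] at h1
    refine h1.congr fun N => ?_
    simp only [Function.comp_apply, hR, mul_assoc]
    rw [sub_div]
  set A : ℕ → Set (ℕ → ℝ) := fun N => {g | R N + coupledEdgeCount N g (N - k) ≤ k + N.choose 2}
    with hA
  have hAm : ∀ N, MeasurableSet (A N) := fun N =>
    measurable_coupledEdgeCount N (N - k)
      (MeasurableSet.of_discrete (s := {m : ℕ | R N + m ≤ k + N.choose 2}))
  have h1 : Tendsto (fun N => gapMeasure (A N)) atTop (𝓝 (gapMeasure {g | x ≤ arrival k g})) := by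
    apply tendsto_measure_of_ae_tendsto_indicator_of_isFiniteMeasure _ _ hAm
    · filter_upwards [ae_gap_pos, ae_tendsto_arrival_div, ae_arrival_ne k x] with g hg hlim hne
      have h2 := tendsto_coupled_atom hg hlim k
      have h3 : ∀ᶠ N : ℕ in atTop, (g ∈ A N ↔ ((R N : ℝ) - k) / (N * Real.log N) ≤
          ((N.choose 2 : ℝ) - (coupledEdgeCount N g (N - k) : ℝ)) / (N * Real.log N)) := by
        filter_upwards [hNlog.eventually_gt_atTop 0] with N hN
        rw [div_le_div_iff_of_pos_right hN, sub_le_sub_iff]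
        simp only [hA, Set.mem_ofPred_eq]
        rw [add_comm k]
        exact_mod_cast Iff.rfl
      rcases lt_or_gt_of_ne hne with h4 | h4
      · obtain ⟨c, hc1, hc2⟩ := exists_between h4
        filter_upwards [h3, h2.eventually_lt_const hc1, hRlim.eventually_const_lt hc2]
          with N h5 h6 h7
        exact h5.trans (iff_of_false (by linarith) h4.not_ge)
      · obtain ⟨c, hc1, hc2⟩ := exists_between h4
        filter_upwards [h3, h2.eventually_const_lt hc2, hRlim.eventually_lt_const hc1]
          with N h5 h6 h7
        exact h5.trans (iff_of_true (by linarith) h4.le)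
    · exact measurableSet_le measurable_const (measurable_arrival k)
  have h2 := (ENNReal.tendsto_toReal (measure_ne_top _ _)).comp h1
  rw [← measureReal_def, gapMeasure_le_arrival k hx] at h2
  refine h2.congr' ?_
  filter_upwards [eventually_floor_le_totalElements x, eventually_ge_atTop k] with N h3 h4
  have h5 := growthMeasure_edgeCount_mem N (Nat.sub_le N k) {m : ℕ | R N + m ≤ k + N.choose 2}
  simp only [Function.comp_apply]
  rw [show A N = {g | coupledEdgeCount N g (N - k) ∈ {m : ℕ | R N + m ≤ k + N.choose 2}} from rfl,
    ← h5, measureReal_def]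
  congr 1
  apply measure_congr
  rw [eventuallyEq_set]
  apply ae_growthMeasure
  intro h hh
  exact (card_virtualVertices_take_le_iff hh h3 h4).symm

theorem tendsto_card_virtualVertices_eq {x : ℝ} (hx : 0 < x) (j : ℕ) :
    Tendsto (fun N : ℕ => (growthMeasure N).real
      {h | (virtualVertices (h.take
        (totalElements N - ⌊x * (N : ℝ) * Real.log N⌋₊))).card = j})
      atTop (𝓝 (Real.exp (-x) * x ^ j / (j.factorial : ℝ))) := by
  cases j with
  | zero =>
    have h := tendsto_card_virtualVertices_le hx 0
    simpa using h
  | succ j =>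
    have h := (tendsto_card_virtualVertices_le hx (j + 1)).sub
      (tendsto_card_virtualVertices_le hx j)
    rw [← mul_sub, Finset.sum_range_succ _ (j + 1), add_sub_cancel_left, ← mul_div_assoc] at h
    refine h.congr fun N => ?_
    rw [← measureReal_sdiff (Set.ofPred_subset_ofPred.2 fun h hh => le_trans hh (Nat.le_succ j))
      (by trivial)]
    congr 1
    ext h
    simp only [Set.mem_sdiff, Set.mem_ofPred_eq]
    omega

end GrowingGraph

theorem theorem6 :
    TendstoInDistribution (fun N : ℕ => GrowingGraph.reversedProcess N) atTop
        GrowingGraph.poissonProcess (fun N : ℕ => GrowingGraph.growthMeasure N)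
        GrowingGraph.gapMeasure ∧
      ∀ x : ℝ, 0 < x → ∀ j : ℕ,
        Tendsto
          (fun N : ℕ => (GrowingGraph.growthMeasure N).real
            {h | (GrowingGraph.virtualVertices (h.take
              (GrowingGraph.totalElements N - ⌊x * (N : ℝ) * Real.log N⌋₊))).card = j})
          atTop (𝓝 (Real.exp (-x) * x ^ j / (j.factorial : ℝ))) :=
  ⟨GrowingGraph.tendstoInDistribution_reversedProcess, fun _ hx j =>
    GrowingGraph.tendsto_card_virtualVertices_eq hx j⟩
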